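/- Let $G$ be a locally compact Hausdorff group with a fixed left Haar measure $\mu$, let $p\in(1,\infty)$ with $p\neq 2$, and let $\mathbb{T}=\{z\in\mathbb{C}: |z|=1\}$. For $s\in G$ let $\lambda_p(s)$ be the isometry of the complex space $L^p(G)=L^p(G,\mu)$ given by $(\lambda_p(s)\xi)(t)=\xi(s^{-1}t)$. For $f\in L^1(G)$ let $\lambda_p(f)\xi=f*\xi=\int_G f(s)\,\lambda_p(s)\xi\,d\mu(s)$ be the operator of left convolution on $L^p(G)$, and let $PF_p(G)\subseteq\mathcal{B}(L^p(G))$ be the operator-norm closure of $\{\lambda_p(f): f\in L^1(G)\}$, a Banach algebra. For a Banach algebra $A$ let $M_l(A)=\{S\in\mathcal{B}(A): S(ab)=S(a)b \text{ for all } a,b\in A\}$ be its left multiplier algebra with the operator norm, and let $\mathcal{U}(M_l(A))$ be the group of invertible isometries in the unital algebra $M_l(A)$. The strict topology on $M_l(A)$ is the topology of pointwise norm convergence on $A$. Write $\mathcal{U}(M_l(A))_{\mathrm{str}}$ for $\mathcal{U}(M_l(A))$ with the strict topology. Let $\mathcal{U}(M_l(A))_0$ be the connected component of the unit of $\mathcal{U}(M_l(A))$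 in the norm topology, a normal subgroup, and let $\pi_0(\mathcal{U}(M_l(A)))=\mathcal{U}(M_l(A))/\mathcal{U}(M_l(A))_0$. Write $\pi_0(\mathcal{U}(M_l(A)))_{\mathrm{str}}$ for this group with the quotient topology induced by $\mathcal{U}(M_l(A))_{\mathrm{str}}\to\pi_0(\mathcal{U}(M_l(A)))$. Then, for $\gamma\in\mathbb{T}$ and $s\in G$, the formula $a\mapsto\gamma\lambda_p(s)a$ defines an element of $\mathcal{U}(M_l(PF_p(G)))$, denoted by $\gamma\lambda_p(s)$, and the maps \[ \Lambda\colon\mathbb{T}\times G\to\mathcal{U}(M_l(PF_p(G)))_{\mathrm{str}},\quad \Lambda(\gamma,s)=\gamma\lambda_p(s), \qquad \Lambda'\colon G\to\pi_0(\mathcal{U}(M_l(PF_p(G))))_{\mathrm{str}},\quad \Lambda'(s)=[\lambda_p(s)], \] are isomorphisms of topological groups. -/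

import Mathlib

open MeasureTheory Filter Topology
open scoped ENNReal NNReal

noncomputable section

/-! ### Invertible isometries of a unital normed ring, and left multipliers -/

section Multipliers

/-- The group of invertible isometries of a unital normed ring `B`: the units `u` of `B` with
`‖u b‖ = ‖b‖` for all `b`. -/
def invertibleIsometries (B : Type*) [NormedRing B] : Subgroup Bˣ where
  carrier := {u | ∀ b : B, ‖(u : B) * b‖ = ‖b‖}
  one_mem' := fun b => by simp
  mul_mem' := fun {u v} hu hv b => by
    rw [Units.val_mul, mul_assoc, hu, hv]
  inv_mem' := fun {u} hu b => by
    rw [← hu (((u⁻¹ : Bˣ) : B) * b), Units.mul_inv_cancel_left]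

/-- The usual norm description of invertible isometries when `‖1‖ = 1`. -/
theorem mem_invertibleIsometries_iff {B : Type*} [NormedRing B] [NormOneClass B] (u : Bˣ) :
    u ∈ invertibleIsometries B ↔ ‖(u : B)‖ = 1 ∧ ‖((u⁻¹ : Bˣ) : B)‖ = 1 := by
  constructor
  · intro hu
    refine ⟨?_, ?_⟩
    · have h := hu 1
      rwa [mul_one, norm_one] at h
    · have h := hu ((u⁻¹ : Bˣ) : B)
      rw [Units.mul_inv, norm_one] at h
      exact h.symm
  · rintro ⟨h1, h2⟩ b
    refine le_antisymm ?_ ?_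
    · calc ‖(u : B) * b‖ ≤ ‖(u : B)‖ * ‖b‖ := norm_mul_le _ _
        _ = ‖b‖ := by rw [h1, one_mul]
    · calc ‖b‖ = ‖((u⁻¹ : Bˣ) : B) * ((u : B) * b)‖ := by rw [Units.inv_mul_cancel_left]
        _ ≤ ‖((u⁻¹ : Bˣ) : B)‖ * ‖(u : B) * b‖ := norm_mul_le _ _
        _ = ‖(u : B) * b‖ := by rw [h2, one_mul]

/-- The topology that Mathlib puts on the invertible isometries (as a subgroup of the units) is
the norm topology. -/
theorem isInducing_coe_invertibleIsometries (B : Type*) [NormedRing B] :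
    IsInducing (fun u : invertibleIsometries B => ((u : Bˣ) : B)) := by
  refine ⟨le_antisymm ?_ ?_⟩
  · exact continuous_iff_le_induced.1 (Units.continuous_val.comp continuous_subtype_val)
  · let τ : TopologicalSpace (invertibleIsometries B) :=
      TopologicalSpace.induced (fun u : invertibleIsometries B => ((u : Bˣ) : B)) inferInstance
    have hval : Continuous[τ, _] (fun u : invertibleIsometries B => ((u : Bˣ) : B)) :=
      continuous_induced_dom
    have hinv : Continuous[τ, _]
        (fun u : invertibleIsometries B => (((u : Bˣ)⁻¹ : Bˣ) : B)) := by
      rw [continuous_iff_continuousAt]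
      intro u
      refine tendsto_iff_norm_sub_tendsto_zero.2 ?_
      have h1 : Tendsto (fun v : invertibleIsometries B =>
          ‖((v : Bˣ) : B) - ((u : Bˣ) : B)‖ * ‖(((u : Bˣ)⁻¹ : Bˣ) : B)‖) (@nhds _ τ u)
          (𝓝 (0 * ‖(((u : Bˣ)⁻¹ : Bˣ) : B)‖)) :=
        (tendsto_iff_norm_sub_tendsto_zero.1 (hval.continuousAt (x := u))).mul_const _
      rw [zero_mul] at h1
      refine squeeze_zero (fun _ => norm_nonneg _) (fun v => ?_) h1
      have h2 : ((v : Bˣ) : B) * ((((v : Bˣ)⁻¹ : Bˣ) : B) - (((u : Bˣ)⁻¹ : Bˣ) : B))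
          = -((((v : Bˣ) : B) - ((u : Bˣ) : B)) * (((u : Bˣ)⁻¹ : Bˣ) : B)) := by
        simp [mul_sub, sub_mul]
      rw [← v.2, h2, norm_neg]
      exact norm_mul_le _ _
    exact continuous_iff_le_induced.1 (Units.continuous_iff.2 ⟨hval, hinv⟩)

/-- The component `𝒰(B)₀` of `1` in the group of invertible isometries in the norm topology. -/
def invertibleIsometriesZero (B : Type*) [NormedRing B] : Subgroup (invertibleIsometries B) :=
  Subgroup.connectedComponentOfOne (invertibleIsometries B)

instance invertibleIsometriesZero_normal (B : Type*) [NormedRing B] :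
    (invertibleIsometriesZero B).Normal where
  conj_mem := fun n hn g => by
    have hc : Continuous (fun x : invertibleIsometries B => g * x * g⁻¹) := by fun_prop
    have h := hc.image_connectedComponent_subset 1
    rw [mul_one, mul_inv_cancel] at h
    exact h ⟨n, hn, rfl⟩

variable (A : Type*) [NonUnitalNormedRing A] [NormedSpace ℂ A] [IsScalarTower ℂ A A]

/-- The left multiplier algebra `M_l(A) = {S ∈ B(A) | S(ab) = S(a)b}`, with the operator norm. -/
def leftMultiplierAlgebra : Subalgebra ℂ (A →L[ℂ] A) where
  carrier := {S | ∀ a b : A, S (a * b) = S a * b}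
  mul_mem' := fun {S T} hS hT a b => by
    change S (T (a * b)) = S (T a) * b
    rw [hT, hS]
  add_mem' := fun {S T} hS hT a b => by
    change S (a * b) + T (a * b) = (S a + T a) * b
    rw [hS, hT, add_mul]
  algebraMap_mem' := fun c a b => by
    change c • (a * b) = c • a * b
    rw [smul_mul_assoc]

/-- The group `𝒰(M_l(A))` of invertible isometries of `M_l(A)`; this is a type synonym that
carries the strict topology. -/
def StrictMultiplierIsometries : Type _ := invertibleIsometries (leftMultiplierAlgebra A)

instance : Group (StrictMultiplierIsometries A) :=
  inferInstanceAs (Group (invertibleIsometries (leftMultiplierAlgebra A)))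

variable {A} in
/-- The bounded operator on `A` given by an element of `𝒰(M_l(A))`. -/
def StrictMultiplierIsometries.toOperator (u : StrictMultiplierIsometries A) : A →L[ℂ] A :=
  (((show invertibleIsometries (leftMultiplierAlgebra A) from u) : (leftMultiplierAlgebra A)ˣ) :
    leftMultiplierAlgebra A)

/-- The strict topology: the topology of pointwise norm convergence on `A`. -/
instance : TopologicalSpace (StrictMultiplierIsometries A) :=
  TopologicalSpace.induced (fun u (a : A) => u.toOperator a) inferInstance

/-- The group `π₀(𝒰(M_l(A))) = 𝒰(M_l(A)) / 𝒰(M_l(A))₀`, where `𝒰(M_l(A))₀` is the connected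
component of `1` in the *norm* topology; this is a type synonym that carries the quotient topology
of the *strict* topology. -/
def StrictMultiplierPiZero : Type _ :=
  invertibleIsometries (leftMultiplierAlgebra A) ⧸ invertibleIsometriesZero (leftMultiplierAlgebra A)

instance : Group (StrictMultiplierPiZero A) :=
  inferInstanceAs (Group (invertibleIsometries (leftMultiplierAlgebra A) ⧸
    invertibleIsometriesZero (leftMultiplierAlgebra A)))

/-- The quotient map `u ↦ [u]` from `𝒰(M_l(A))` to `π₀(𝒰(M_l(A)))`. -/
def StrictMultiplierPiZero.mk : StrictMultiplierIsometries A →* StrictMultiplierPiZero A :=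
  QuotientGroup.mk' (invertibleIsometriesZero (leftMultiplierAlgebra A))

instance : TopologicalSpace (StrictMultiplierPiZero A) :=
  TopologicalSpace.coinduced (StrictMultiplierPiZero.mk A) inferInstance

end Multipliers

/-! ### The regular representation and pseudofunctions -/

section Pseudofunctions

/-- A product of an integrable function with a bounded continuous vector-valued function on a Hausdorff space is
Bochner integrable; no countability assumption on `X` is needed. -/
theorem integrable_smul_of_continuous {X : Type*} [TopologicalSpace X] [T2Space X]
    [MeasurableSpace X] [BorelSpace X] {E : Type*} [NormedAddCommGroup E]
    [NormedSpace ℂ E] (μ : Measure X)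
    [μ.InnerRegularCompactLTTop] {f : X → ℂ} (hf : Integrable f μ) {φ : X → E}
    (hφ : Continuous φ) {C : ℝ} (hC : ∀ s, ‖φ s‖ ≤ C) :
    Integrable (fun s => f s • φ s) μ := by
  have hmeas : AEStronglyMeasurable (fun s => f s • φ s) μ := by
    obtain ⟨g, hgm, hfg⟩ := hf.aestronglyMeasurable
    have hg : Integrable g μ := hf.congr hfg
    refine AEStronglyMeasurable.congr (f := fun s => g s • φ s) ?_
      (by filter_upwards [hfg] with s hs; rw [hs])
    -- `g` is supported on the sets where it is at least `1 / (n + 1)`, of finite measure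
    let S : ℕ → Set X := fun n => {s | 1 / ((n : ℝ) + 1) ≤ ‖g s‖}
    have hSm : ∀ n, MeasurableSet (S n) := fun n =>
      measurableSet_le measurable_const hgm.norm.measurable
    have hSfin : ∀ n, μ (S n) ≠ ∞ := fun n =>
      (hg.measure_norm_ge_lt_top (by positivity)).ne
    have hS : ∀ n, AEStronglyMeasurable (fun s => g s • φ s) (μ.restrict (S n)) := by
      intro n
      have hK : ∀ k : ℕ, ∃ K ⊆ S n, IsCompact K ∧ μ (S n \ K) < ((k : ℝ≥0∞) + 1)⁻¹ := fun k =>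
        (hSm n).exists_isCompact_sdiff_lt (hSfin n) (by simp)
      choose K hKS hKc hKμ using hK
      have hnull : μ (S n \ ⋃ k, K k) = 0 := by
        refine le_antisymm (ENNReal.le_of_forall_pos_le_add fun ε hε _ => ?_) zero_le
        obtain ⟨k, hk⟩ := ENNReal.exists_inv_nat_lt (a := (ε : ℝ≥0∞)) (by simpa using hε.ne')
        rw [zero_add]
        calc μ (S n \ ⋃ k, K k) ≤ μ (S n \ K k) :=
              measure_mono (Set.sdiff_subset_sdiff_right (Set.subset_iUnion K k))
          _ ≤ ((k : ℝ≥0∞) + 1)⁻¹ := (hKμ k).le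
          _ ≤ (k : ℝ≥0∞)⁻¹ := ENNReal.inv_le_inv.2 le_self_add
          _ ≤ ε := hk.le
      have hae : S n =ᵐ[μ] ⋃ k, K k :=
        (ae_le_set.2 hnull).antisymm (Set.iUnion_subset hKS).eventuallyLE
      rw [Measure.restrict_congr_set hae, aestronglyMeasurable_iUnion_iff]
      intro k
      exact hgm.aestronglyMeasurable.smul
        (hφ.continuousOn.aestronglyMeasurable_of_isCompact (hKc k) (hKc k).measurableSet)
    have hU : AEStronglyMeasurable (fun s => g s • φ s) (μ.restrict (⋃ n, S n)) :=
      aestronglyMeasurable_iUnion_iff.2 hS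
    have hUm : MeasurableSet (⋃ n, S n) := MeasurableSet.iUnion hSm
    have hzero : (⋃ n, S n).indicator (fun s => g s • φ s) = fun s => g s • φ s := by
      refine Set.indicator_eq_self.2 fun s hs => ?_
      have hgs : g s ≠ 0 := fun h => hs (by simp [h])
      obtain ⟨n, hn⟩ := exists_nat_one_div_lt (norm_pos_iff.2 hgs)
      exact Set.mem_iUnion.2 ⟨n, hn.le⟩
    rw [← hzero]
    exact (aestronglyMeasurable_indicator_iff hUm).2 hU
  refine (hf.norm.mul_const C).mono' hmeas (Eventually.of_forall fun s => ?_)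
  rw [norm_smul]
  exact mul_le_mul_of_nonneg_left (hC s) (norm_nonneg _)

variable {G : Type*} [Group G] [TopologicalSpace G] [IsTopologicalGroup G]
  [MeasurableSpace G] [BorelSpace G]

/-- The left regular representation on `L^p(G)`: `(λ_p(s) ξ)(t) = ξ(s⁻¹ t)`. -/
def leftRegular (p : ℝ≥0∞) [Fact (1 ≤ p)] (μ : Measure G) [μ.IsMulLeftInvariant] (s : G) :
    Lp ℂ p μ →L[ℂ] Lp ℂ p μ :=
  (Lp.compMeasurePreservingₗᵢ ℂ (fun t : G => s⁻¹ * t)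
    (measurePreserving_mul_left μ s⁻¹)).toContinuousLinearMap

theorem leftRegular_coeFn (p : ℝ≥0∞) [Fact (1 ≤ p)] (μ : Measure G) [μ.IsMulLeftInvariant] (s : G)
    (ξ : Lp ℂ p μ) : leftRegular p μ s ξ =ᵐ[μ] fun t => ξ (s⁻¹ * t) :=
  Lp.coeFn_compMeasurePreserving ξ (measurePreserving_mul_left μ s⁻¹)

theorem norm_leftRegular_apply (p : ℝ≥0∞) [Fact (1 ≤ p)] (μ : Measure G) [μ.IsMulLeftInvariant]
    (s : G) (ξ : Lp ℂ p μ) : ‖leftRegular p μ s ξ‖ = ‖ξ‖ :=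
  Lp.norm_compMeasurePreserving ξ (measurePreserving_mul_left μ s⁻¹)

theorem leftRegular_mul_apply (p : ℝ≥0∞) [Fact (1 ≤ p)] (μ : Measure G) [μ.IsMulLeftInvariant]
    (s t : G) (ξ : Lp ℂ p μ) :
    leftRegular p μ (s * t) ξ = leftRegular p μ s (leftRegular p μ t ξ) := by
  have h := Lp.compMeasurePreserving_comp_apply ξ (measurePreserving_mul_left μ t⁻¹)
    (measurePreserving_mul_left μ s⁻¹)
  refine Eq.trans ?_ h
  refine Lp.ext ?_
  filter_upwards [leftRegular_coeFn p μ (s * t) ξ,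
    Lp.coeFn_compMeasurePreserving ξ ((measurePreserving_mul_left μ t⁻¹).comp
      (measurePreserving_mul_left μ s⁻¹))] with x h1 h2
  rw [h1, h2]
  simp [mul_assoc]

theorem continuous_leftRegular_apply [LocallyCompactSpace G] (p : ℝ≥0∞) [Fact (1 ≤ p)]
    [Fact (p ≠ ∞)] (μ : Measure G)
    [μ.IsHaarMeasure] [μ.InnerRegularCompactLTTop] (ξ : Lp ℂ p μ) :
    Continuous (fun s : G => leftRegular p μ s ξ) := by
  have hc : Continuous (fun q : G × G => q.1⁻¹ * q.2) := by fun_prop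
  exact Continuous.compMeasurePreservingLp (f := fun _ : G => ξ)
    (g := fun s : G => (⟨fun t => s⁻¹ * t, by fun_prop⟩ : C(G, G))) continuous_const
    (ContinuousMap.curry ⟨_, hc⟩).continuous (fun s => measurePreserving_mul_left μ s⁻¹) Fact.out

variable [LocallyCompactSpace G] [T2Space G] (p : ℝ≥0∞) [Fact (1 ≤ p)] [Fact (p ≠ ∞)]
  (μ : Measure G) [μ.IsHaarMeasure] [μ.InnerRegularCompactLTTop]

theorem integrable_smul_leftRegular (f : Lp ℂ 1 μ) (ξ : Lp ℂ p μ) :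
    Integrable (fun s => f s • leftRegular p μ s ξ) μ :=
  integrable_smul_of_continuous μ (L1.integrable_coeFn f) (continuous_leftRegular_apply p μ ξ)
    (fun s => (norm_leftRegular_apply p μ s ξ).le)

/-- The integrated form of `λ_p`, that is, the representation of `L¹(G)` on `L^p(G)` by left
convolution: `λ_p(f) ξ = f * ξ = ∫ f(s) λ_p(s) ξ dμ(s)`, a Bochner integral in `L^p(G)`. -/
def leftConvolution : Lp ℂ 1 μ →L[ℂ] Lp ℂ p μ →L[ℂ] Lp ℂ p μ :=
  LinearMap.mkContinuous₂
    (LinearMap.mk₂ ℂ (fun (f : Lp ℂ 1 μ) (ξ : Lp ℂ p μ) => ∫ s, f s • leftRegular p μ s ξ ∂μ)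
      (by
        intro f g ξ
        rw [← integral_add (integrable_smul_leftRegular p μ f ξ)
          (integrable_smul_leftRegular p μ g ξ)]
        refine integral_congr_ae ?_
        filter_upwards [Lp.coeFn_add f g] with s hs
        rw [hs, Pi.add_apply, add_smul])
      (by
        intro c f ξ
        rw [← integral_smul]
        refine integral_congr_ae ?_
        filter_upwards [Lp.coeFn_smul c f] with s hs
        rw [hs, Pi.smul_apply, smul_assoc])
      (by
        intro f ξ η
        rw [← integral_add (integrable_smul_leftRegular p μ f ξ)
          (integrable_smul_leftRegular p μ f η)]
        simp only [map_add, smul_add])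
      (by
        intro c f ξ
        rw [← integral_smul]
        simp only [map_smul, smul_comm c]))
    1
    (by
      intro f ξ
      rw [LinearMap.mk₂_apply, one_mul, L1.norm_eq_integral_norm, ← integral_mul_const]
      refine (norm_integral_le_integral_norm _).trans (le_of_eq ?_)
      simp only [norm_smul, norm_leftRegular_apply])

theorem leftConvolution_apply (f : Lp ℂ 1 μ) (ξ : Lp ℂ p μ) :
    leftConvolution p μ f ξ = ∫ s, f s • leftRegular p μ s ξ ∂μ := rfl

/-- `λ_p(f) λ_p(g) = λ_p(f * g)`. -/
theorem leftConvolution_mul (f g : Lp ℂ 1 μ) :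
    leftConvolution p μ f * leftConvolution p μ g
      = leftConvolution p μ (haveI : Fact ((1 : ℝ≥0∞) ≠ ∞) := ⟨ENNReal.one_ne_top⟩
          leftConvolution 1 μ f g) := by
  have : Fact ((1 : ℝ≥0∞) ≠ ∞) := ⟨ENNReal.one_ne_top⟩
  have hinv : ∀ (s : G) (ξ : Lp ℂ p μ), leftRegular p μ s (leftConvolution p μ g ξ)
      = leftConvolution p μ (leftRegular 1 μ s g) ξ := by
    intro s ξ
    rw [leftConvolution_apply, leftConvolution_apply,
      ← ContinuousLinearMap.integral_comp_comm _ (integrable_smul_leftRegular p μ g ξ),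
      ← integral_mul_left_eq_self
        (fun t => (leftRegular 1 μ s g) t • leftRegular p μ t ξ) s]
    refine integral_congr_ae ?_
    filter_upwards [(measurePreserving_mul_left μ s).quasiMeasurePreserving.ae_eq_comp
      (leftRegular_coeFn 1 μ s g)] with t ht
    simp only [Function.comp_apply, inv_mul_cancel_left] at ht
    rw [ht, map_smul, leftRegular_mul_apply]
  refine ContinuousLinearMap.ext fun ξ => ?_
  have h := ContinuousLinearMap.integral_comp_comm ((leftConvolution p μ).flip ξ)
    (integrable_smul_leftRegular 1 μ f g)
  change leftConvolution p μ f (leftConvolution p μ g ξ)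
    = (leftConvolution p μ).flip ξ (leftConvolution 1 μ f g)
  rw [leftConvolution_apply 1, ← h, leftConvolution_apply]
  refine integral_congr_ae (Eventually.of_forall fun s => ?_)
  simp only [hinv, map_smul, ContinuousLinearMap.flip_apply]

/-- The image `λ_p(L¹(G))`, a subalgebra of `B(L^p(G))`. -/
def convolutionOperators : NonUnitalSubalgebra ℂ (Lp ℂ p μ →L[ℂ] Lp ℂ p μ) where
  carrier := Set.range (leftConvolution p μ)
  zero_mem' := ⟨0, map_zero _⟩
  add_mem' := by
    rintro _ _ ⟨f, rfl⟩ ⟨g, rfl⟩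
    exact ⟨f + g, map_add _ _ _⟩
  smul_mem' := by
    rintro c _ ⟨f, rfl⟩
    exact ⟨c • f, map_smul _ _ _⟩
  mul_mem' := by
    rintro _ _ ⟨f, rfl⟩ ⟨g, rfl⟩
    exact ⟨_, (leftConvolution_mul p μ f g).symm⟩

/-- The Banach algebra `PF_p(G)` of `p`-pseudofunctions: the norm closure of `λ_p(L¹(G))` in
`B(L^p(G))`. -/
def pseudofunctions : NonUnitalSubalgebra ℂ (Lp ℂ p μ →L[ℂ] Lp ℂ p μ) :=
  (convolutionOperators p μ).topologicalClosure

/-- `PF_p(G)` is a complex normed space in the operator norm. -/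
instance : NormedSpace ℂ (pseudofunctions p μ) where
  norm_smul_le := fun c a => norm_smul_le c (a : Lp ℂ p μ →L[ℂ] Lp ℂ p μ)

end Pseudofunctions

end

set_option linter.unusedSectionVars false

open scoped CompactlySupported Pointwise

/-! The heart of the matter is that an invertible isometric left multiplier of `PF_p(G)` is some `γ
λ_p(s)`. Normalised indicators of small compact neighbourhoods of `1` give a contractive approximate
unit `e_K`; the operators `S(e_K)` converge strongly to some `T` with `S(a) = T a`, and
contractivity of `S` and its inverse makes `T` an isometry of `L^p(G)`
(`exists_linearIsometry_of_leftMultiplier`).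

Two properties of `T` are then played against each other. Since `p ≠ 2`, the equality case of
Clarkson's inequality shows that `T` preserves disjointness of supports
(`LinearIsometry.disjoint_of_disjoint`). Being a strong limit of pseudofunctions, `T` commutes with
right convolution (`convGraph_multiplier`), so it sends continuous functions `k * ζ` to continuous
functions `T k * ζ`, compatibly with right translation (`Intertwines`). Images of bumps at `1`
concentrate at a point `s`, and disjointness forces `T` to move every support by `s`
(`exists_translation`). The isometry `λ_p(s⁻¹) T` is then local, and a norm estimate near `1` makes
it a scalar (`exists_eq_smul_of_isLocalIsometry`).

The topological statements rest on one vector: if `V V⁻¹ ⊆ W`, the indicator of `V` is moved by at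
least its norm by every `γ λ_p(s)` with `s ∉ W` (`exists_norm_le_norm_circleRegular_sub`). This
gives continuity of the inverse for the strict topology. It also makes `G` discrete in norm, so that
the norm component of `1` is exactly the circle of scalars, and dividing by it leaves `G`. -/

/-! ### Clarkson's inequality for complex numbers, with its equality case -/

theorem rpow_add_strict_sub {q x y : ℝ} (hq : q < 1) (hx : 0 < x) (hy : 0 < y) :
    (x + y) ^ q < x ^ q + y ^ q := by
  -- Split `(x + y) ^ q` as `x * (x + y) ^ (q - 1) + y * (x + y) ^ (q - 1)`; the power `q - 1` is
  -- strictly decreasing.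
  have h : ∀ {z w : ℝ}, 0 < z → 0 < w → z * (z + w) ^ (q - 1) < z ^ q := by
    intro z w hz hw
    calc z * (z + w) ^ (q - 1) < z * z ^ (q - 1) :=
          mul_lt_mul_of_pos_left (Real.rpow_lt_rpow_of_neg hz (by linarith) (by linarith)) hz
      _ = z ^ q := by rw [Real.rpow_sub_one hz.ne']; field_simp
  have h1 := h hx hy
  have h2 := h hy hx
  have h3 : (x + y) ^ q = x * (x + y) ^ (q - 1) + y * (y + x) ^ (q - 1) := by
    rw [add_comm y x, ← add_mul, Real.rpow_sub_one (by positivity)]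
    field_simp
  linarith

theorem rpow_add_strict_super {q x y : ℝ} (hq : 1 < q) (hx : 0 < x) (hy : 0 < y) :
    x ^ q + y ^ q < (x + y) ^ q := by
  have h : ∀ {z w : ℝ}, 0 < z → 0 < w → z ^ q < z * (z + w) ^ (q - 1) := by
    intro z w hz hw
    calc z ^ q = z * z ^ (q - 1) := by rw [Real.rpow_sub_one hz.ne']; field_simp
      _ < z * (z + w) ^ (q - 1) :=
          mul_lt_mul_of_pos_left (Real.rpow_lt_rpow hz.le (by linarith) (by linarith)) hz
  have h1 := h hx hy
  have h2 := h hy hx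
  have h3 : (x + y) ^ q = x * (x + y) ^ (q - 1) + y * (y + x) ^ (q - 1) := by
    rw [add_comm y x, ← add_mul, Real.rpow_sub_one (by positivity)]
    field_simp
  linarith

theorem norm_rpow_eq_sq_rpow {E : Type*} [SeminormedAddGroup E] (r : ℝ) (a : E) : ‖a‖ ^ r = (‖a‖ ^ 2) ^ (r / 2) := by
  rw [← Real.rpow_natCast, ← Real.rpow_mul (norm_nonneg _)]
  congr 1
  push_cast
  ring

/-- Concavity of `t ^ (r / 2)` at `‖a + b‖ ^ 2` and `‖a - b‖ ^ 2`, whose sum is given by the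
parallelogram law, followed by strict subadditivity of the same power. For `r > 2` both steps
reverse. -/
theorem clarkson_sub {r : ℝ} (hr0 : 0 < r) (hr : r < 2) (a b : ℂ) :
    ‖a + b‖ ^ r + ‖a - b‖ ^ r ≤ 2 * (‖a‖ ^ r + ‖b‖ ^ r) ∧
    (a ≠ 0 → b ≠ 0 → ‖a + b‖ ^ r + ‖a - b‖ ^ r < 2 * (‖a‖ ^ r + ‖b‖ ^ r)) := by
  have hpar : ‖a + b‖ ^ 2 + ‖a - b‖ ^ 2 = 2 * (‖a‖ ^ 2 + ‖b‖ ^ 2) := by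
    have := parallelogram_law_with_norm ℝ a b
    nlinarith
  have h1 : ‖a + b‖ ^ r + ‖a - b‖ ^ r ≤ 2 * (‖a‖ ^ 2 + ‖b‖ ^ 2) ^ (r / 2) := by
    rw [norm_rpow_eq_sq_rpow r (a + b), norm_rpow_eq_sq_rpow r (a - b)]
    have hc := (Real.concaveOn_rpow (p := r / 2) (by linarith) (by linarith)).2
      (Set.mem_Ici.2 (sq_nonneg ‖a + b‖)) (Set.mem_Ici.2 (sq_nonneg ‖a - b‖))
      one_half_pos.le one_half_pos.le (by norm_num)
    simp only [smul_eq_mul] at hc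
    rw [← mul_add, ← mul_add, hpar, ← mul_assoc] at hc
    norm_num at hc
    linarith
  have h2 : a ≠ 0 → b ≠ 0 → (‖a‖ ^ 2 + ‖b‖ ^ 2) ^ (r / 2) < ‖a‖ ^ r + ‖b‖ ^ r := by
    intro ha hb
    rw [norm_rpow_eq_sq_rpow r a, norm_rpow_eq_sq_rpow r b]
    exact rpow_add_strict_sub (by linarith) (by positivity) (by positivity)
  refine ⟨?_, fun ha hb => by linarith [h2 ha hb]⟩
  by_cases ha : a = 0
  · subst ha; simp [Real.zero_rpow hr0.ne']; linarith
  by_cases hb : b = 0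
  · subst hb; simp [Real.zero_rpow hr0.ne']; linarith
  linarith [h2 ha hb]

theorem clarkson_super {r : ℝ} (hr : 2 < r) (a b : ℂ) :
    2 * (‖a‖ ^ r + ‖b‖ ^ r) ≤ ‖a + b‖ ^ r + ‖a - b‖ ^ r ∧
    (a ≠ 0 → b ≠ 0 → 2 * (‖a‖ ^ r + ‖b‖ ^ r) < ‖a + b‖ ^ r + ‖a - b‖ ^ r) := by
  have hr0 : 0 < r := by linarith
  have hpar : ‖a + b‖ ^ 2 + ‖a - b‖ ^ 2 = 2 * (‖a‖ ^ 2 + ‖b‖ ^ 2) := by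
    have := parallelogram_law_with_norm ℝ a b
    nlinarith
  have h1 : 2 * (‖a‖ ^ 2 + ‖b‖ ^ 2) ^ (r / 2) ≤ ‖a + b‖ ^ r + ‖a - b‖ ^ r := by
    rw [norm_rpow_eq_sq_rpow r (a + b), norm_rpow_eq_sq_rpow r (a - b)]
    have hc := (convexOn_rpow (p := r / 2) (by linarith)).2
      (Set.mem_Ici.2 (sq_nonneg ‖a + b‖)) (Set.mem_Ici.2 (sq_nonneg ‖a - b‖))
      one_half_pos.le one_half_pos.le (by norm_num)
    simp only [smul_eq_mul] at hc
    rw [← mul_add, ← mul_add, hpar, ← mul_assoc] at hc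
    norm_num at hc
    linarith
  have h2 : a ≠ 0 → b ≠ 0 → ‖a‖ ^ r + ‖b‖ ^ r < (‖a‖ ^ 2 + ‖b‖ ^ 2) ^ (r / 2) := by
    intro ha hb
    rw [norm_rpow_eq_sq_rpow r a, norm_rpow_eq_sq_rpow r b]
    exact rpow_add_strict_super (by linarith) (by positivity) (by positivity)
  refine ⟨?_, fun ha hb => by linarith [h2 ha hb]⟩
  by_cases ha : a = 0
  · subst ha; simp [Real.zero_rpow hr0.ne']; linarith
  by_cases hb : b = 0
  · subst hb; simp [Real.zero_rpow hr0.ne']; linarith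
  linarith [h2 ha hb]

/-- The sign `σ` merges the cases `r < 2` and `r > 2`, so that the integrated argument is made only
once. -/
theorem exists_sign_clarkson {r : ℝ} (hr0 : 0 < r) (hr : r ≠ 2) :
    ∃ σ : ℝ, ∀ a b : ℂ, 0 ≤ σ * (‖a + b‖ ^ r + ‖a - b‖ ^ r - 2 * (‖a‖ ^ r + ‖b‖ ^ r)) ∧
      (σ * (‖a + b‖ ^ r + ‖a - b‖ ^ r - 2 * (‖a‖ ^ r + ‖b‖ ^ r)) = 0 → a = 0 ∨ b = 0) := by
  rcases lt_or_gt_of_ne hr with h | h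
  · refine ⟨-1, fun a b => ⟨by linarith [(clarkson_sub hr0 h a b).1], fun h0 => ?_⟩⟩
    by_contra! hab
    linarith [(clarkson_sub hr0 h a b).2 hab.1 hab.2]
  · refine ⟨1, fun a b => ⟨by linarith [(clarkson_super h a b).1], fun h0 => ?_⟩⟩
    by_contra! hab
    linarith [(clarkson_super h a b).2 hab.1 hab.2]

/-! ### Isometries of `L^p` preserve disjointness -/

section

variable {α : Type*} [MeasurableSpace α] {μ : Measure α} {p : ℝ≥0∞}

theorem Lp_norm_rpow_eq_integral (hp0 : p ≠ 0) (hp : p ≠ ∞) (u : Lp ℂ p μ) :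
    ‖u‖ ^ p.toReal = ∫ x, ‖u x‖ ^ p.toReal ∂μ := by
  have h0 : 0 < p.toReal := ENNReal.toReal_pos hp0 hp
  rw [Lp.norm_def, toReal_eLpNorm (Lp.aestronglyMeasurable u),
    lpNorm_eq_integral_norm_rpow_toReal hp0 hp (Lp.aestronglyMeasurable u),
    ← Real.rpow_mul (integral_nonneg fun x => Real.rpow_nonneg (norm_nonneg _) _),
    inv_mul_cancel₀ h0.ne', Real.rpow_one]

theorem Lp_integrable_norm_rpow (hp0 : p ≠ 0) (hp : p ≠ ∞) (u : Lp ℂ p μ) :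
    Integrable (fun x => ‖u x‖ ^ p.toReal) μ :=
  (Lp.memLp u).integrable_norm_rpow hp0 hp

/-- The defect in the parallelogram law for the `p`-th powers of the norms in `L^p`. -/
theorem integral_clarkson (hp0 : p ≠ 0) (hp : p ≠ ∞) (u v : Lp ℂ p μ) :
    Integrable (fun x => ‖u x + v x‖ ^ p.toReal + ‖u x - v x‖ ^ p.toReal
        - 2 * (‖u x‖ ^ p.toReal + ‖v x‖ ^ p.toReal)) μ ∧
    ‖u + v‖ ^ p.toReal + ‖u - v‖ ^ p.toReal - 2 * (‖u‖ ^ p.toReal + ‖v‖ ^ p.toReal)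
      = ∫ x, (‖u x + v x‖ ^ p.toReal + ‖u x - v x‖ ^ p.toReal
        - 2 * (‖u x‖ ^ p.toReal + ‖v x‖ ^ p.toReal)) ∂μ := by
  have ha : (fun x => ‖(u + v : Lp ℂ p μ) x‖ ^ p.toReal) =ᵐ[μ]
      fun x => ‖u x + v x‖ ^ p.toReal := by
    filter_upwards [Lp.coeFn_add u v] with x hx
    rw [hx, Pi.add_apply]
  have hs : (fun x => ‖(u - v : Lp ℂ p μ) x‖ ^ p.toReal) =ᵐ[μ]
      fun x => ‖u x - v x‖ ^ p.toReal := by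
    filter_upwards [Lp.coeFn_sub u v] with x hx
    rw [hx, Pi.sub_apply]
  have i1 := (Lp_integrable_norm_rpow hp0 hp (u + v)).congr ha
  have i2 := (Lp_integrable_norm_rpow hp0 hp (u - v)).congr hs
  have i3 := ((Lp_integrable_norm_rpow hp0 hp u).add
    (Lp_integrable_norm_rpow hp0 hp v)).const_mul 2
  refine ⟨(i1.add i2).sub i3, ?_⟩
  have hsum := integral_sub (i1.add i2) i3
  have hadd := integral_add i1 i2
  have hadd' := integral_add (Lp_integrable_norm_rpow hp0 hp u) (Lp_integrable_norm_rpow hp0 hp v)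
  simp only [Pi.add_apply, integral_const_mul] at hsum hadd hadd'
  rw [hsum, hadd, hadd', Lp_norm_rpow_eq_integral hp0 hp, Lp_norm_rpow_eq_integral hp0 hp,
    Lp_norm_rpow_eq_integral hp0 hp, Lp_norm_rpow_eq_integral hp0 hp, integral_congr_ae ha,
    integral_congr_ae hs]

/-- A linear isometry of `L^p`, `p ≠ 2`, preserves disjointness of supports. -/
theorem LinearIsometry.disjoint_of_disjoint [Fact (1 ≤ p)] (hp : p ≠ ∞) (hp2 : p ≠ 2)
    (T : Lp ℂ p μ →ₗᵢ[ℂ] Lp ℂ p μ) {u v : Lp ℂ p μ} (huv : ∀ᵐ x ∂μ, u x = 0 ∨ v x = 0) :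
    ∀ᵐ x ∂μ, T u x = 0 ∨ T v x = 0 := by
  have hp0 : p ≠ 0 := (zero_lt_one.trans_le (Fact.out : 1 ≤ p)).ne'
  have hr0 : 0 < p.toReal := ENNReal.toReal_pos hp0 hp
  have hr2 : p.toReal ≠ 2 := fun h => hp2 (by
    rw [← ENNReal.ofReal_toReal hp, h, ENNReal.ofReal_ofNat])
  obtain ⟨σ, hσ⟩ := exists_sign_clarkson hr0 hr2
  have h0 : ‖u + v‖ ^ p.toReal + ‖u - v‖ ^ p.toReal
      - 2 * (‖u‖ ^ p.toReal + ‖v‖ ^ p.toReal) = 0 := by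
    rw [(integral_clarkson hp0 hp u v).2]
    refine integral_eq_zero_of_ae ?_
    filter_upwards [huv] with x hx
    rcases hx with hx | hx <;> simp [hx, Real.zero_rpow hr0.ne'] <;> ring
  -- The defect involves only four norms, all preserved by `T`. So the defect of `T u` and `T v` has
  -- zero integral too, and having constant sign it vanishes almost everywhere.
  rw [← T.norm_map (u + v), ← T.norm_map (u - v), map_add, map_sub, ← T.norm_map u,
    ← T.norm_map v, (integral_clarkson hp0 hp (T u) (T v)).2] at h0
  have h1 : ∫ x, σ * (‖T u x + T v x‖ ^ p.toReal + ‖T u x - T v x‖ ^ p.toReal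
        - 2 * (‖T u x‖ ^ p.toReal + ‖T v x‖ ^ p.toReal)) ∂μ = 0 := by
    rw [integral_const_mul, h0, mul_zero]
  rw [integral_eq_zero_iff_of_nonneg (fun x => (hσ _ _).1)
    ((integral_clarkson hp0 hp (T u) (T v)).1.const_mul σ)] at h1
  filter_upwards [h1] with x hx
  exact (hσ _ _).2 hx

end

/-! ### Compact inner regularity and density of `C_c` in `L^p` -/

section InnerRegular

variable {X : Type*} [TopologicalSpace X] [T2Space X] [MeasurableSpace X] [BorelSpace X]
  {μ : Measure X} {p : ℝ≥0∞}

/-- A set on which an element of `L^p` does not vanish is null as soon as it is null in every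
compact set. -/
theorem Lp.measure_zero_of_forall_isCompact [μ.InnerRegularCompactLTTop] (hp0 : p ≠ 0)
    (hp : p ≠ ∞) (u : Lp ℂ p μ) {N : Set X} (hN : ∀ x ∈ N, u x ≠ 0)
    (h : ∀ K, IsCompact K → μ (N ∩ K) = 0) : μ N = 0 := by
  let S : ℕ → Set X := fun n => {s | 1 / ((n : ℝ) + 1) ≤ ‖u s‖}
  have hSm : ∀ n, MeasurableSet (S n) := fun n =>
    measurableSet_le measurable_const (Lp.stronglyMeasurable u).norm.measurable
  have hSfin : ∀ n, μ (S n) ≠ ∞ := fun n => by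
    have := (Lp.memLp u).meas_ge_lt_top hp0 hp (ε := 1 / ((n : ℝ≥0) + 1)) (by positivity)
    refine ne_of_lt (lt_of_le_of_lt (measure_mono fun x hx => ?_) this)
    change _ ≤ ‖u x‖₊
    rw [← NNReal.coe_le_coe]
    simpa [S] using hx
  have hS : ∀ n, μ (N ∩ S n) = 0 := by
    intro n
    refine le_antisymm (ENNReal.le_of_forall_pos_le_add fun ε hε _ => ?_) zero_le
    obtain ⟨K, hKS, hK, hμ⟩ := (hSm n).exists_isCompact_sdiff_lt (hSfin n)
      (ENNReal.coe_ne_zero.2 hε.ne')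
    calc μ (N ∩ S n) ≤ μ ((N ∩ K) ∪ (S n \ K)) := measure_mono fun x hx => by
          by_cases hxK : x ∈ K
          · exact Or.inl ⟨hx.1, hxK⟩
          · exact Or.inr ⟨hx.2, hxK⟩
      _ ≤ μ (N ∩ K) + μ (S n \ K) := measure_union_le _ _
      _ ≤ 0 + ε := add_le_add (h K hK).le hμ.le
  refine measure_mono_null (t := ⋃ n, N ∩ S n) (fun x hx => ?_) (measure_iUnion_null hS)
  obtain ⟨n, hn⟩ := exists_nat_one_div_lt (norm_pos_iff.2 (hN x hx))
  exact Set.mem_iUnion.2 ⟨n, hx, hn.le⟩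

/-- The class in `L^p` of a compactly supported continuous function. -/
noncomputable def ccLp {X : Type*} [TopologicalSpace X] [MeasurableSpace X]
    [OpensMeasurableSpace X] (p : ℝ≥0∞) (μ : Measure X) [IsFiniteMeasureOnCompacts μ] (f : C_c(X, ℂ)) :
    Lp ℂ p μ :=
  (f.continuous.memLp_of_hasCompactSupport f.hasCompactSupport).toLp f

theorem coeFn_ccLp {X : Type*} [TopologicalSpace X] [MeasurableSpace X] [OpensMeasurableSpace X]
    {μ : Measure X} {p : ℝ≥0∞} [IsFiniteMeasureOnCompacts μ] (f : C_c(X, ℂ)) : ccLp p μ f =ᵐ[μ] f := MemLp.coeFn_toLp _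

/-- By `Lp.induction` it suffices to approximate the indicator of a set `s` of finite measure. Take
a compact `K ⊆ s` and an open `V ⊇ K`, both close to optimal, and a Urysohn function for `K ⊆ V`:
the error is bounded by `‖c‖` and lives on `(s \ K) ∪ (V \ K)`. -/
theorem Lp.mem_of_forall_ccLp_mem [LocallyCompactSpace X] [μ.InnerRegularCompactLTTop]
    [IsFiniteMeasureOnCompacts μ] [Fact (1 ≤ p)] (hp : p ≠ ∞)
    (M : Submodule ℂ (Lp ℂ p μ)) (hM : IsClosed (M : Set (Lp ℂ p μ)))
    (h : ∀ f : C_c(X, ℂ), ccLp p μ f ∈ M) (u : Lp ℂ p μ) : u ∈ M := by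
  induction u using Lp.induction hp with
  | isClosed => exact hM
  | add hf hg _ h1 h2 => exact M.add_mem h1 h2
  | indicatorConst c hs hμs =>
    rename_i s
    rw [Lp.simpleFunc.coe_indicatorConst]
    refine hM.closure_subset (EMetric.mem_closure_iff.2 fun ε hε => ?_)
    obtain ⟨δ, hδ, hδε⟩ := exists_between hε
    obtain ⟨η, hη, hηs⟩ := exists_eLpNorm_indicator_le (μ := μ) hp c hδ.ne'
    have hη2 : ((η / 2 : ℝ≥0) : ℝ≥0∞) ≠ 0 := ENNReal.coe_ne_zero.2 (by positivity)
    obtain ⟨K, hKs, hK, hμK⟩ := hs.exists_isCompact_sdiff_lt hμs.ne hη2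
    obtain ⟨V, hKV, hV, hμV⟩ := hK.exists_isOpen_lt_add (μ := μ) hη2
    have hμV' : μ (V \ K) ≤ (η / 2 : ℝ≥0) := by
      rw [measure_sdiff hKV hK.measurableSet.nullMeasurableSet hK.measure_lt_top.ne]
      exact tsub_le_iff_left.2 hμV.le
    obtain ⟨f, hf1, hfc, hfV, hf01⟩ := exists_continuousMap_one_of_isCompact_subset_isOpen hK hV hKV
    let g : C_c(X, ℂ) := ⟨⟨fun x => (f x : ℂ) * c, by fun_prop⟩,
      (HasCompactSupport.comp_left (g := fun t : ℝ => (t : ℂ)) hfc (by simp)).mul_right⟩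
    refine ⟨_, h g, ?_⟩
    rw [edist_comm, Lp.edist_def]
    refine lt_of_le_of_lt ?_ hδε
    · refine le_trans ?_ (hηs ((s \ K) ∪ (V \ K)) ?_)
      · refine eLpNorm_mono_ae ?_
        filter_upwards [coeFn_ccLp (p := p) (μ := μ) g,
          indicatorConstLp_coeFn (p := p) (hs := hs) (hμs := hμs.ne) (c := c)] with x h1 h2
        rw [Pi.sub_apply, h1, h2]
        change ‖(f x : ℂ) * c - _‖ ≤ _
        by_cases hxK : x ∈ K
        · simp [hf1 hxK, hKs hxK]
        · by_cases hxV : x ∈ V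
          · rw [Set.indicator_of_mem (show x ∈ (s \ K) ∪ (V \ K) from Or.inr ⟨hxV, hxK⟩)]
            have h01 := hf01 x
            by_cases hxs : x ∈ s
            · rw [Set.indicator_of_mem hxs, ← sub_one_mul, norm_mul]
              refine mul_le_of_le_one_left (norm_nonneg _) ?_
              rw [← Complex.ofReal_one, ← Complex.ofReal_sub, Complex.norm_real, Real.norm_eq_abs,
                abs_le]
              constructor <;> linarith [h01.1, h01.2]
            · rw [Set.indicator_of_notMem hxs, sub_zero, norm_mul, Complex.norm_real,
                Real.norm_eq_abs, abs_of_nonneg h01.1]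
              exact mul_le_of_le_one_left (norm_nonneg _) h01.2
          · have hfx : f x = 0 := image_eq_zero_of_notMem_tsupport fun hx => hxV (hfV hx)
            by_cases hxs : x ∈ s
            · rw [Set.indicator_of_mem hxs,
                Set.indicator_of_mem (show x ∈ (s \ K) ∪ (V \ K) from Or.inl ⟨hxs, hxK⟩)]
              simp [hfx]
            · simp [hfx, hxs]
      · refine (measure_union_le _ _).trans ((add_le_add hμK.le hμV').trans (le_of_eq ?_))
        rw [← ENNReal.coe_add, add_halves]

end InnerRegular

/-! ### Averages over small compact neighbourhoods of the identity -/

section ApproximateUnit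

/-- The filter of small compact neighbourhoods of `x`. -/
def smallCompactNhds {X : Type*} [TopologicalSpace X] (x : X) : Filter (Set X) :=
  (𝓝 x).smallSets ⊓ 𝓟 {K | IsCompact K ∧ K ∈ 𝓝 x}

instance {X : Type*} [TopologicalSpace X] [LocallyCompactSpace X] (x : X) :
    (smallCompactNhds x).NeBot := by
  rw [smallCompactNhds, ← frequently_mem_iff_neBot, frequently_smallSets]
  intro t ht
  obtain ⟨K, hK, hKt, hKc⟩ := local_compact_nhds ht
  exact ⟨K, hKt, hKc, hK⟩

theorem eventually_smallCompactNhds {X : Type*} [TopologicalSpace X] (x : X) :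
    ∀ᶠ K in smallCompactNhds x, IsCompact K ∧ K ∈ 𝓝 x :=
  mem_inf_of_right (mem_principal_self _)

theorem eventually_subset_smallCompactNhds {X : Type*} [TopologicalSpace X] {x : X} {U : Set X}
    (hU : U ∈ 𝓝 x) : ∀ᶠ K in smallCompactNhds x, K ⊆ U :=
  mem_inf_of_left (eventually_smallSets_subset.2 hU)

variable {G : Type*} [TopologicalSpace G] [T2Space G]
  [MeasurableSpace G] [BorelSpace G] (μ : Measure G) [IsFiniteMeasureOnCompacts μ]

open Classical in
/-- The normalised indicator function of `K`, as an element of `L^1`. -/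
noncomputable def averagingKernel (K : Set G) : Lp ℂ 1 μ :=
  if h : IsCompact K then
    indicatorConstLp 1 h.measurableSet h.measure_lt_top.ne (((μ.real K)⁻¹ : ℝ) : ℂ)
  else 0

theorem norm_averagingKernel_le (K : Set G) : ‖averagingKernel μ K‖ ≤ 1 := by
  unfold averagingKernel
  split_ifs with h
  · rw [norm_indicatorConstLp one_ne_zero ENNReal.one_ne_top]
    simp only [Complex.norm_real, norm_inv, ENNReal.toReal_one, div_one, Real.rpow_one]
    rw [Real.norm_of_nonneg measureReal_nonneg]
    exact inv_mul_le_one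
  · simp

theorem integral_averagingKernel_smul {E : Type*} [NormedAddCommGroup E] [NormedSpace ℂ E]
    {K : Set G} (hK : IsCompact K) (φ : G → E) :
    ∫ s, averagingKernel μ K s • φ s ∂μ = ⨍ s in K, φ s ∂μ := by
  rw [setAverage_eq, averagingKernel, dif_pos hK, ← integral_smul, ← integral_indicator
    hK.measurableSet]
  refine integral_congr_ae ?_
  filter_upwards [indicatorConstLp_coeFn (p := 1) (hs := hK.measurableSet)
    (hμs := (hK.measure_lt_top (μ := μ)).ne) (c := (((μ.real K)⁻¹ : ℝ) : ℂ))] with s hs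
  rw [hs]
  by_cases h : s ∈ K
  · simp only [h, Set.indicator_of_mem, ← Complex.coe_smul]
  · simp [h]

/-- The integral is the average of `φ` over `K`, which stays in any closed ball, a convex set,
containing `φ '' K`. -/
theorem tendsto_integral_averagingKernel_smul [Group G] [μ.IsOpenPosMeasure]
    {E : Type*} [NormedAddCommGroup E]   [NormedSpace ℂ E] [CompleteSpace E] {φ : G → E} (hφ : Continuous φ) :
    Tendsto (fun K => ∫ s, averagingKernel μ K s • φ s ∂μ) (smallCompactNhds (1 : G))
      (𝓝 (φ 1)) := by
  refine (Metric.nhds_basis_closedBall.tendsto_right_iff).2 fun ε hε => ?_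
  have h1 : φ ⁻¹' (Metric.closedBall (φ 1) ε) ∈ 𝓝 (1 : G) :=
    hφ.continuousAt (Metric.closedBall_mem_nhds _ hε)
  filter_upwards [eventually_smallCompactNhds (1 : G), eventually_subset_smallCompactNhds h1]
    with K hK hKs
  rw [integral_averagingKernel_smul μ hK.1]
  refine (convex_closedBall (φ 1) ε).set_average_mem Metric.isClosed_closedBall
    (Measure.measure_pos_of_mem_nhds μ hK.2).ne' hK.1.measure_lt_top.ne ?_ ?_
  · exact ae_restrict_of_forall_mem hK.1.measurableSet hKs
  · exact (hφ.continuousOn).integrableOn_compact hK.1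

end ApproximateUnit

/-! ### The approximate unit of `PF_p(G)`, and multipliers as operators on `L^p(G)` -/

section PseudofunctionsUnit

variable {G : Type*} [Group G] [TopologicalSpace G] [IsTopologicalGroup G]
  [MeasurableSpace G] [BorelSpace G] (p : ℝ≥0∞) [Fact (1 ≤ p)]

section

variable (μ : Measure G) [μ.IsMulLeftInvariant]

theorem leftRegular_one : leftRegular p μ (1 : G) = 1 := by
  ext1 ξ
  refine Lp.ext ?_
  filter_upwards [leftRegular_coeFn p μ 1 ξ] with x hx
  simpa using hx

end

variable [LocallyCompactSpace G] [T2Space G] [Fact (p ≠ ∞)] (μ : Measure G) [μ.IsHaarMeasure]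
  [μ.InnerRegularCompactLTTop]

theorem tendsto_leftConvolution_averagingKernel (ξ : Lp ℂ p μ) :
    Tendsto (fun K => leftConvolution p μ (averagingKernel μ K) ξ) (smallCompactNhds (1 : G))
      (𝓝 ξ) := by
  have h := tendsto_integral_averagingKernel_smul μ (continuous_leftRegular_apply p μ ξ)
  rwa [leftRegular_one, one_apply_eq_self] at h

theorem norm_leftConvolution_le : ‖leftConvolution p μ‖ ≤ 1 :=
  LinearMap.mkContinuous₂_norm_le _ zero_le_one _

theorem leftConvolution_mem (f : Lp ℂ 1 μ) : leftConvolution p μ f ∈ pseudofunctions p μ :=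
  (convolutionOperators p μ).le_topologicalClosure ⟨f, rfl⟩

/-- The pseudofunction `λ_p(f)`. -/
noncomputable def convolutionPseudofunction (f : Lp ℂ 1 μ) : pseudofunctions p μ :=
  ⟨leftConvolution p μ f, leftConvolution_mem p μ f⟩

theorem norm_convolutionPseudofunction_le (f : Lp ℂ 1 μ) :
    ‖convolutionPseudofunction p μ f‖ ≤ ‖f‖ := by
  refine ((leftConvolution p μ).le_opNorm f).trans ?_
  exact mul_le_of_le_one_left (norm_nonneg _) (norm_leftConvolution_le p μ)

/-- The approximate unit of `PF_p(G)`. -/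
noncomputable def approximateUnit (K : Set G) : pseudofunctions p μ :=
  convolutionPseudofunction p μ (averagingKernel μ K)

theorem norm_approximateUnit_le (K : Set G) : ‖approximateUnit p μ K‖ ≤ 1 :=
  (norm_convolutionPseudofunction_le p μ _).trans (norm_averagingKernel_le μ K)

theorem tendsto_approximateUnit_apply (ξ : Lp ℂ p μ) :
    Tendsto (fun K => (approximateUnit p μ K : Lp ℂ p μ →L[ℂ] Lp ℂ p μ) ξ)
      (smallCompactNhds (1 : G)) (𝓝 ξ) :=
  tendsto_leftConvolution_averagingKernel p μ ξ

/-- A property of pseudofunctions which is closed and holds for `λ_p(L^1(G))` holds everywhere. -/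
theorem pseudofunctions_induction {P : (Lp ℂ p μ →L[ℂ] Lp ℂ p μ) → Prop}
    (hP : IsClosed {a | P a}) (h : ∀ f : Lp ℂ 1 μ, P (leftConvolution p μ f))
    (a : pseudofunctions p μ) : P a := by
  have h1 : (convolutionOperators p μ : Set (Lp ℂ p μ →L[ℂ] Lp ℂ p μ)) ⊆ {a | P a} := by
    rintro _ ⟨f, rfl⟩
    exact h f
  exact closure_minimal h1 hP a.2

/-- Contractivity of the approximate unit makes the set of good `a` closed. For `a = λ_p(f)`, the
product is `λ_p` of an average of translates of `f`, which converges in `L¹`. -/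
theorem tendsto_approximateUnit_mul (a : pseudofunctions p μ) :
    Tendsto (fun K => approximateUnit p μ K * a) (smallCompactNhds (1 : G)) (𝓝 a) := by
  rw [tendsto_subtype_rng]
  refine pseudofunctions_induction p μ (P := fun a => Tendsto
    (fun K => (approximateUnit p μ K : Lp ℂ p μ →L[ℂ] Lp ℂ p μ) * a)
    (smallCompactNhds (1 : G)) (𝓝 a)) ?_ ?_ a
  · refine isClosed_of_closure_subset fun b hb => ?_
    refine Metric.tendsto_nhds.2 fun ε hε => ?_
    obtain ⟨c, hc, hbc⟩ := Metric.mem_closure_iff.1 hb (ε / 3) (by positivity)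
    filter_upwards [(Metric.tendsto_nhds.1 hc) (ε / 3) (by positivity)] with K hK
    rw [dist_eq_norm] at *
    have h1 : ‖(approximateUnit p μ K : Lp ℂ p μ →L[ℂ] Lp ℂ p μ) * (b - c)‖ < ε / 3 := by
      refine (norm_mul_le _ _).trans_lt (lt_of_le_of_lt ?_ hbc)
      exact mul_le_of_le_one_left (norm_nonneg _) (norm_approximateUnit_le p μ K)
    calc ‖(approximateUnit p μ K : Lp ℂ p μ →L[ℂ] Lp ℂ p μ) * b - b‖
        = ‖(approximateUnit p μ K : Lp ℂ p μ →L[ℂ] Lp ℂ p μ) * (b - c)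
          + ((approximateUnit p μ K : Lp ℂ p μ →L[ℂ] Lp ℂ p μ) * c - c) - (b - c)‖ := by
          congr 1; rw [mul_sub]; abel
      _ ≤ _ := (norm_sub_le _ _).trans (add_le_add_left (norm_add_le _ _) _)
      _ < ε := by linarith
  · intro f
    have : Fact ((1 : ℝ≥0∞) ≠ ∞) := ⟨ENNReal.one_ne_top⟩
    have h := ((leftConvolution p μ).continuous.tendsto f).comp
      (tendsto_leftConvolution_averagingKernel 1 μ f)
    refine h.congr fun K => ?_
    exact (leftConvolution_mul p μ _ _).symm

variable {p μ}

/-- Two operators on `L^p(G)` with the same products with pseudofunctions are equal. -/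
theorem eq_of_forall_comp_pseudofunction_eq {T T' : Lp ℂ p μ →L[ℂ] Lp ℂ p μ}
    (h : ∀ a : pseudofunctions p μ, T * (a : Lp ℂ p μ →L[ℂ] Lp ℂ p μ) = T' * a) : T = T' := by
  ext1 ξ
  have h1 := (T.continuous.tendsto ξ).comp (tendsto_approximateUnit_apply p μ ξ)
  have h2 := (T'.continuous.tendsto ξ).comp (tendsto_approximateUnit_apply p μ ξ)
  refine tendsto_nhds_unique h1 (h2.congr fun K => ?_)
  exact (DFunLike.congr_fun (h (approximateUnit p μ K)) ξ).symm

/-- Bounds for the left multiplication by `T` pass to `T` itself, since `T ξ` is the limit of `T e_K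
ξ` with `‖e_K‖ ≤ 1`. -/
theorem norm_le_of_forall_comp_pseudofunction {T : Lp ℂ p μ →L[ℂ] Lp ℂ p μ} {C : ℝ}
    (hC : 0 ≤ C) (h : ∀ a : pseudofunctions p μ, ‖T * (a : Lp ℂ p μ →L[ℂ] Lp ℂ p μ)‖ ≤ C * ‖a‖)
    (ξ : Lp ℂ p μ) : ‖T ξ‖ ≤ C * ‖ξ‖ := by
  refine le_of_tendsto ((T.continuous.tendsto ξ).comp (tendsto_approximateUnit_apply p μ ξ)).norm
    (Eventually.of_forall fun K => ?_)
  calc _ = ‖(T * (approximateUnit p μ K : Lp ℂ p μ →L[ℂ] Lp ℂ p μ)) ξ‖ := rfl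
    _ ≤ ‖T * (approximateUnit p μ K : Lp ℂ p μ →L[ℂ] Lp ℂ p μ)‖ * ‖ξ‖ :=
      ContinuousLinearMap.le_opNorm _ _
    _ ≤ (C * ‖approximateUnit p μ K‖) * ‖ξ‖ := by gcongr; exact h _
    _ ≤ C * ‖ξ‖ := by
      gcongr
      exact mul_le_of_le_one_right hC (norm_approximateUnit_le p μ K)

/-- Every contractive left multiplier of `PF_p(G)` is the left multiplication by an operator on
`L^p(G)`. -/
theorem exists_operator_of_leftMultiplier
    {S : pseudofunctions p μ → pseudofunctions p μ} (hSm : ∀ a b, S (a * b) = S a * b)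
    (hSc : Continuous S) (hS : ∀ a, ‖S a‖ ≤ ‖a‖) :
    ∃ T : Lp ℂ p μ →L[ℂ] Lp ℂ p μ, ∀ a : pseudofunctions p μ,
      (S a : Lp ℂ p μ →L[ℂ] Lp ℂ p μ) = T * (a : Lp ℂ p μ →L[ℂ] Lp ℂ p μ) := by
  let φ : Set G → Lp ℂ p μ →L[ℂ] Lp ℂ p μ := fun K => (S (approximateUnit p μ K) : _)
  have hφ : ∀ K, ‖φ K‖ ≤ 1 := fun K =>
    (hS _).trans (norm_approximateUnit_le p μ K)
  -- The multiplier identity gives `S(e_K) a = S(e_K a) → S(a)`: convergence holds on vectors `a ξ`.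
  have h1 : ∀ (a : pseudofunctions p μ) (ξ : Lp ℂ p μ),
      Tendsto (fun K => φ K ((a : Lp ℂ p μ →L[ℂ] Lp ℂ p μ) ξ)) (smallCompactNhds (1 : G))
        (𝓝 ((S a : Lp ℂ p μ →L[ℂ] Lp ℂ p μ) ξ)) := by
    intro a ξ
    have h2 : Tendsto (fun K => S (approximateUnit p μ K * a)) (smallCompactNhds (1 : G))
      (𝓝 (S a)) := (hSc.tendsto a).comp (tendsto_approximateUnit_mul p μ a)
    have h3 := ((ContinuousLinearMap.apply ℂ (Lp ℂ p μ) ξ).continuous.tendsto _).comp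
      ((continuous_subtype_val.tendsto _).comp h2)
    refine h3.congr fun K => ?_
    change ((S (approximateUnit p μ K * a) : pseudofunctions p μ) : Lp ℂ p μ →L[ℂ] Lp ℂ p μ) ξ = _
    rw [hSm]
    rfl
  -- The `φ K` are uniformly contractive, so it is enough to replace `ξ` by a nearby vector `e_L ξ`,
  -- where convergence is known.
  have h2 : ∀ ξ : Lp ℂ p μ, ∃ η, Tendsto (fun K => φ K ξ) (smallCompactNhds (1 : G)) (𝓝 η) := by
    intro ξ
    rw [← cauchy_map_iff_exists_tendsto, Metric.cauchy_iff]
    refine ⟨inferInstance, fun ε hε => ?_⟩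
    obtain ⟨L, hL⟩ := ((Metric.tendsto_nhds.1 (tendsto_approximateUnit_apply p μ ξ)) (ε / 3)
      (by positivity)).exists
    set ζ := (approximateUnit p μ L : Lp ℂ p μ →L[ℂ] Lp ℂ p μ) ξ with hζ
    have h3 := (Metric.tendsto_nhds.1 (h1 (approximateUnit p μ L) ξ)) (ε / 6) (by positivity)
    refine ⟨_, image_mem_map h3, ?_⟩
    have key : ∀ K, dist (φ K ξ) (φ K ζ) ≤ ε / 3 := by
      intro K
      rw [dist_eq_norm, ← map_sub]
      refine ((φ K).le_of_opNorm_le (hφ K) _).trans ?_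
      rw [one_mul, ← dist_eq_norm, dist_comm]
      exact hL.le
    rintro _ ⟨K, hK, rfl⟩ _ ⟨K', hK', rfl⟩
    have t1 := dist_triangle4 (φ K ξ) (φ K ζ) (φ K' ζ) (φ K' ξ)
    have t2 := dist_triangle_right (φ K ζ) (φ K' ζ)
      ((S (approximateUnit p μ L) : Lp ℂ p μ →L[ℂ] Lp ℂ p μ) ξ)
    have t3 := key K
    have t4 := key K'
    rw [dist_comm] at t4
    simp only [Set.mem_ofPred_eq] at hK hK'
    linarith
  choose T hT using h2
  refine ⟨ContinuousLinearMap.ofTendstoOfBoundedRange (l := smallCompactNhds (1 : G)) T φ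
    (tendsto_pi_nhds.2 hT) ?_, fun a => ?_⟩
  · refine isBounded_iff_forall_norm_le.2 ⟨1, ?_⟩
    rintro _ ⟨K, rfl⟩
    exact hφ K
  · ext1 ξ
    exact tendsto_nhds_unique (h1 a ξ) (hT _)

/-- Every isometric left multiplier of `PF_p(G)` with a contractive inverse is the left
multiplication by a linear isometry of `L^p(G)`. -/
theorem exists_linearIsometry_of_leftMultiplier
    {S S' : pseudofunctions p μ → pseudofunctions p μ} (hSm : ∀ a b, S (a * b) = S a * b)
    (hSm' : ∀ a b, S' (a * b) = S' a * b) (hSc : Continuous S) (hSc' : Continuous S')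
    (hS : ∀ a, ‖S a‖ ≤ ‖a‖) (hS' : ∀ a, ‖S' a‖ ≤ ‖a‖) (h : ∀ a, S' (S a) = a) :
    ∃ T : Lp ℂ p μ →ₗᵢ[ℂ] Lp ℂ p μ, ∀ a : pseudofunctions p μ,
      (S a : Lp ℂ p μ →L[ℂ] Lp ℂ p μ) = T.toContinuousLinearMap * a := by
  obtain ⟨T, hT⟩ := exists_operator_of_leftMultiplier hSm hSc hS
  obtain ⟨T', hT'⟩ := exists_operator_of_leftMultiplier hSm' hSc' hS'
  have hT'T : T' * T = 1 := eq_of_forall_comp_pseudofunction_eq fun a => by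
    rw [mul_assoc, ← hT, ← hT', one_mul, h]
  have hle : ∀ ξ, ‖T ξ‖ ≤ ‖ξ‖ := fun ξ => by
    rw [← one_mul ‖ξ‖]
    refine norm_le_of_forall_comp_pseudofunction zero_le_one (fun a => ?_) ξ
    rw [← hT, one_mul]
    exact hS a
  have hle' : ∀ ξ, ‖T' ξ‖ ≤ ‖ξ‖ := fun ξ => by
    rw [← one_mul ‖ξ‖]
    refine norm_le_of_forall_comp_pseudofunction zero_le_one (fun a => ?_) ξ
    rw [← hT', one_mul]
    exact hS' a
  refine ⟨⟨T.toLinearMap, fun ξ => le_antisymm (hle ξ) ?_⟩, hT⟩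
  calc ‖ξ‖ = ‖T' (T ξ)‖ := by rw [← mul_apply_eq_comp, hT'T]; rfl
    _ ≤ ‖T ξ‖ := hle' _

end PseudofunctionsUnit

/-! ### Right convolution with compactly supported continuous functions -/

section Pairing

variable {X : Type*} [MeasurableSpace X] {μ : Measure X}

/-- Integration against a function which belongs to all `L^q` is continuous on `L^p`. -/
theorem exists_continuousLinearMap_integral_mul (p : ℝ≥0∞) [Fact (1 ≤ p)] {g : X → ℂ}
    (hg : ∀ q, MemLp g q μ) : ∃ L : Lp ℂ p μ →L[ℂ] ℂ, ∀ h, L h = ∫ x, h x * g x ∂μ := by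
  -- `(1 - p⁻¹)⁻¹` is the conjugate exponent of `p`, equal to `∞` when `p = 1`.
  have := ENNReal.HolderConjugate.inv_one_sub_inv' (Fact.out : 1 ≤ p)
  have : Fact (1 ≤ (1 - p⁻¹)⁻¹) := by simp [fact_iff]
  refine ⟨((ContinuousLinearMap.mul ℂ ℂ).lpPairing μ p (1 - p⁻¹)⁻¹).flip ((hg _).toLp g),
    fun h => ?_⟩
  rw [ContinuousLinearMap.flip_apply, ContinuousLinearMap.lpPairing_eq_integral]
  refine integral_congr_ae ?_
  filter_upwards [(hg (1 - p⁻¹)⁻¹).coeFn_toLp] with x hx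
  rw [hx]
  rfl

end Pairing

theorem Lp.integrableOn_of_measure_lt_top {X : Type*} [MeasurableSpace X] {μ : Measure X}
    {p : ℝ≥0∞} [Fact (1 ≤ p)] (u : Lp ℂ p μ) {E : Set X} (hE : μ E < ∞) : IntegrableOn u E μ := by
  have : Fact (μ E < ∞) := ⟨hE⟩
  exact ((Lp.memLp u).restrict E).integrable Fact.out

/-- The quotient map by `M` is continuous and commutes with the integral. Without integrability the
integral is the default `0`, which also lies in `M`. -/
theorem integral_mem_submodule {X E : Type*} [MeasurableSpace X] {μ : Measure X}
    [NormedAddCommGroup E] [NormedSpace ℂ E] [CompleteSpace E] {M : Submodule ℂ E}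
    (hM : IsClosed (M : Set E)) {f : X → E} (hf : ∀ x, f x ∈ M) : ∫ x, f x ∂μ ∈ M := by
  by_cases hi : Integrable f μ
  · have : IsClosed (M : Set E) := hM
    rw [← Submodule.Quotient.mk_eq_zero, ← Submodule.mkQ_apply, ← Submodule.coe_mkQL,
      ← ContinuousLinearMap.integral_comp_comm _ hi]
    refine integral_eq_zero_of_ae (Eventually.of_forall fun x => ?_)
    exact (Submodule.Quotient.mk_eq_zero M).2 (hf x)
  · rw [integral_undef hi]
    exact M.zero_mem

section RightConvolution

variable {G : Type*} [Group G] [TopologicalSpace G] [IsTopologicalGroup G]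

/-- The function `y ↦ ζ(y⁻¹ x)`. -/
noncomputable def invTranslate (ζ : C_c(G, ℂ)) (x : G) : C_c(G, ℂ) where
  toFun y := ζ (y⁻¹ * x)
  hasCompactSupport' := ζ.hasCompactSupport.comp_homeomorph
    ((Homeomorph.inv G).trans (Homeomorph.mulRight x))

/-- The function `y ↦ ζ(y t)`. -/
noncomputable def rightTranslate (ζ : C_c(G, ℂ)) (t : G) : C_c(G, ℂ) where
  toFun y := ζ (y * t)
  hasCompactSupport' := ζ.hasCompactSupport.comp_homeomorph (Homeomorph.mulRight t)

variable [MeasurableSpace G] [BorelSpace G] [LocallyCompactSpace G] [T2Space G] {p : ℝ≥0∞}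
  {μ : Measure G}

/-- The convolution `x ↦ ∫ h(y) ζ(y⁻¹ x) dμ(y)` of `h` with a compactly supported continuous
function. -/
noncomputable def rightConv (h : Lp ℂ p μ) (ζ : C_c(G, ℂ)) (x : G) : ℂ :=
  ∫ y, h y * ζ (y⁻¹ * x) ∂μ

/-- A right translation of `h * ζ` affects only `ζ`, while `T` will act only on `h`. This expresses
that `T` commutes with right translations without introducing them as operators on `L^p(G)`. -/
theorem rightConv_rightTranslate (h : Lp ℂ p μ) (ζ : C_c(G, ℂ)) (x t : G) :
    rightConv h (rightTranslate ζ t) x = rightConv h ζ (x * t) := by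
  refine integral_congr_ae (Eventually.of_forall fun y => ?_)
  change h y * ζ (y⁻¹ * x * t) = h y * ζ (y⁻¹ * (x * t))
  rw [mul_assoc]

theorem rightConv_leftRegular [Fact (1 ≤ p)] [μ.IsMulLeftInvariant] (s : G) (h : Lp ℂ p μ)
    (ζ : C_c(G, ℂ)) (x : G) :
    rightConv (leftRegular p μ s h) ζ x = rightConv h ζ (s⁻¹ * x) := by
  rw [rightConv, rightConv, ← integral_mul_left_eq_self (fun y => h y * _) s⁻¹]
  refine integral_congr_ae ?_
  filter_upwards [leftRegular_coeFn p μ s h] with y hy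
  rw [hy]
  simp [mul_assoc]

variable [IsFiniteMeasureOnCompacts μ] [Fact (1 ≤ p)]

variable (p μ) in
theorem exists_continuousLinearMap_rightConv (ζ : C_c(G, ℂ)) (x : G) :
    ∃ L : Lp ℂ p μ →L[ℂ] ℂ, ∀ h, L h = rightConv h ζ x :=
  exists_continuousLinearMap_integral_mul p (g := invTranslate ζ x) fun _ =>
    (invTranslate ζ x).continuous.memLp_of_hasCompactSupport (invTranslate ζ x).hasCompactSupport

/-- For `x` in a compact `N` the integrand is supported in the compact set `N * (tsupport ζ)⁻¹`, on
which `h` is integrable. -/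
theorem continuous_rightConv (h : Lp ℂ p μ) (ζ : C_c(G, ℂ)) : Continuous (rightConv h ζ) := by
  refine continuous_iff_continuousAt.2 fun x => ?_
  obtain ⟨N, hN, hNx⟩ := exists_compact_mem_nhds x
  refine ContinuousOn.continuousAt (s := N) ?_ hNx
  refine continuousOn_integral_bilinear_of_locally_integrable_of_compact_support
    (ContinuousLinearMap.mul ℂ ℂ) (k := N * (tsupport ζ)⁻¹)
    (hN.mul (IsCompact.inv ζ.hasCompactSupport)) (f := fun x y => ζ (y⁻¹ * x)) ?_ ?_ ?_
  · have : Continuous (fun q : G × G => ζ (q.2⁻¹ * q.1)) := by fun_prop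
    exact this.continuousOn
  · intro z y hz hy
    refine image_eq_zero_of_notMem_tsupport fun h' => hy ?_
    exact ⟨z, hz, (y⁻¹ * z)⁻¹, Set.inv_mem_inv.2 h', by simp⟩
  · exact ((Lp.memLp h).locallyIntegrable Fact.out).integrableOn_isCompact
      (hN.mul (IsCompact.inv ζ.hasCompactSupport))

/-- The continuous function `F` represents `u`, in the sense that they agree almost everywhere in
each compact set. -/
def RepresentedBy (u : Lp ℂ p μ) (F : G → ℂ) : Prop :=
  ∀ K, IsCompact K → ∀ᵐ x ∂μ.restrict K, u x = F x

variable (p μ) in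
/-- The closed space of the pairs `(u, h)` such that `u` is the convolution of `h` with `ζ`. -/
noncomputable def convGraph (ζ : C_c(G, ℂ)) : Submodule ℂ (Lp ℂ p μ × Lp ℂ p μ) where
  carrier := {w | RepresentedBy w.1 (rightConv w.2 ζ)}
  zero_mem' := fun K _ => by
    refine ae_restrict_of_ae ?_
    filter_upwards [Lp.coeFn_zero ℂ p μ] with x hx
    obtain ⟨L, hL⟩ := exists_continuousLinearMap_rightConv p μ ζ x
    rw [Prod.fst_zero, Prod.snd_zero, hx, ← hL, map_zero]
    rfl
  add_mem' := fun {w z} hw hz K hK => by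
    filter_upwards [ae_restrict_of_ae (Lp.coeFn_add w.1 z.1), hw K hK, hz K hK] with x hx h1 h2
    obtain ⟨L, hL⟩ := exists_continuousLinearMap_rightConv p μ ζ x
    rw [Prod.fst_add, Prod.snd_add, hx, ← hL, map_add, hL, hL, Pi.add_apply, h1, h2]
  smul_mem' := fun c w hw K hK => by
    filter_upwards [ae_restrict_of_ae (Lp.coeFn_smul c w.1), hw K hK] with x hx h1
    obtain ⟨L, hL⟩ := exists_continuousLinearMap_rightConv p μ ζ x
    rw [Prod.smul_fst, Prod.smul_snd, hx, ← hL, map_smul, hL, Pi.smul_apply, h1]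

theorem mem_convGraph {ζ : C_c(G, ℂ)} {w : Lp ℂ p μ × Lp ℂ p μ} :
    w ∈ convGraph p μ ζ ↔ RepresentedBy w.1 (rightConv w.2 ζ) := Iff.rfl

/-- Convergence in `L^p` of the first components gives convergence almost everywhere along a
subsequence; for the second components, `h ↦ (h * ζ)(x)` is continuous at every `x`. -/
theorem isClosed_convGraph (ζ : C_c(G, ℂ)) :
    IsClosed (convGraph p μ ζ : Set (Lp ℂ p μ × Lp ℂ p μ)) := by
  refine IsSeqClosed.isClosed fun w z hw hwz K hK => ?_
  have h1 : Tendsto (fun n => (w n).1) atTop (𝓝 z.1) := (continuous_fst.tendsto z).comp hwz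
  have h2 : Tendsto (fun n => (w n).2) atTop (𝓝 z.2) := (continuous_snd.tendsto z).comp hwz
  obtain ⟨ns, hns, hae⟩ := (tendstoInMeasure_of_tendsto_Lp h1).exists_seq_tendsto_ae
  have h3 : ∀ᵐ x ∂μ.restrict K, ∀ n, (w n).1 x = rightConv (w n).2 ζ x :=
    ae_all_iff.2 fun n => hw n K hK
  filter_upwards [ae_restrict_of_ae hae, h3] with x hx hx3
  obtain ⟨L, hL⟩ := exists_continuousLinearMap_rightConv p μ ζ x
  have h4 := ((L.continuous.tendsto _).comp h2).comp hns.tendsto_atTop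
  rw [hL] at h4
  refine tendsto_nhds_unique hx (h4.congr fun n => ?_)
  simp [hL, hx3]

end RightConvolution

section RightConvolutionHaar

variable {G : Type*} [Group G] [TopologicalSpace G] [IsTopologicalGroup G]
  [MeasurableSpace G] [BorelSpace G] [LocallyCompactSpace G] [T2Space G] {p : ℝ≥0∞}
  [Fact (1 ≤ p)] [Fact (p ≠ ∞)] {μ : Measure G} [μ.IsHaarMeasure] [μ.InnerRegularCompactLTTop]

theorem hasCompactSupport_rightConv (k ζ : C_c(G, ℂ)) :
    HasCompactSupport (rightConv (ccLp p μ k) ζ) := by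
  refine HasCompactSupport.intro (K := tsupport k * tsupport ζ)
    (IsCompact.mul k.hasCompactSupport ζ.hasCompactSupport) fun x hx => ?_
  refine integral_eq_zero_of_ae ?_
  filter_upwards [coeFn_ccLp (p := p) (μ := μ) k] with y hy
  rw [hy]
  by_contra h0
  obtain ⟨h1, h2⟩ := mul_ne_zero_iff.1 h0
  exact hx ⟨y, subset_tsupport _ h1, _, subset_tsupport _ h2, by simp⟩

theorem RepresentedBy.leftRegular {u : Lp ℂ p μ} {F : G → ℂ} (h : RepresentedBy u F) (s : G) :
    RepresentedBy (leftRegular p μ s u) fun x => F (s⁻¹ * x) := by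
  intro K hK
  have h1 := h (s⁻¹ • K) (hK.smul _)
  rw [ae_restrict_iff' (hK.smul _).measurableSet] at h1
  rw [ae_restrict_iff' hK.measurableSet]
  filter_upwards [leftRegular_coeFn p μ s u,
    (measurePreserving_mul_left μ s⁻¹).quasiMeasurePreserving.ae h1] with x hx h2 hxK
  rw [hx]
  exact h2 ⟨x, hxK, rfl⟩

theorem convGraph_leftRegular (ζ : C_c(G, ℂ)) (s : G) {w : Lp ℂ p μ × Lp ℂ p μ}
    (hw : w ∈ convGraph p μ ζ) :
    (leftRegular p μ s w.1, leftRegular p μ s w.2) ∈ convGraph p μ ζ := by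
  intro K hK
  filter_upwards [(mem_convGraph.1 hw).leftRegular s K hK] with x hx
  rw [hx, rightConv_leftRegular]

theorem convGraph_leftConvolution (ζ : C_c(G, ℂ)) (f : Lp ℂ 1 μ) {w : Lp ℂ p μ × Lp ℂ p μ}
    (hw : w ∈ convGraph p μ ζ) :
    (leftConvolution p μ f w.1, leftConvolution p μ f w.2) ∈ convGraph p μ ζ := by
  rw [leftConvolution_apply, leftConvolution_apply,
    ← integral_pair (integrable_smul_leftRegular p μ f w.1)
      (integrable_smul_leftRegular p μ f w.2)]
  exact integral_mem_submodule (isClosed_convGraph ζ) fun s =>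
    (convGraph p μ ζ).smul_mem (f s) (convGraph_leftRegular ζ s hw)

theorem convGraph_pseudofunction (ζ : C_c(G, ℂ)) (a : pseudofunctions p μ)
    {w : Lp ℂ p μ × Lp ℂ p μ} (hw : w ∈ convGraph p μ ζ) :
    ((a : Lp ℂ p μ →L[ℂ] Lp ℂ p μ) w.1, (a : Lp ℂ p μ →L[ℂ] Lp ℂ p μ) w.2)
      ∈ convGraph p μ ζ := by
  refine pseudofunctions_induction p μ (P := fun a => (a w.1, a w.2) ∈ convGraph p μ ζ) ?_
    (fun f => convGraph_leftConvolution ζ f hw) a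
  refine (isClosed_convGraph ζ).preimage (f := fun a : Lp ℂ p μ →L[ℂ] Lp ℂ p μ => (a w.1, a w.2)) ?_
  fun_prop

/-- The graph is closed and invariant under left translations, hence under their integrals `λ_p(f)`,
norm limits of these, and finally `T` as the strong limit of the pseudofunctions `T e_K`. -/
theorem convGraph_multiplier (ζ : C_c(G, ℂ)) {T : Lp ℂ p μ →L[ℂ] Lp ℂ p μ}
    (hT : ∀ a : pseudofunctions p μ, T * a ∈ pseudofunctions p μ)
    {w : Lp ℂ p μ × Lp ℂ p μ} (hw : w ∈ convGraph p μ ζ) :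
    (T w.1, T w.2) ∈ convGraph p μ ζ := by
  have h1 := (T.continuous.tendsto w.1).comp (tendsto_approximateUnit_apply p μ w.1)
  have h2 := (T.continuous.tendsto w.2).comp (tendsto_approximateUnit_apply p μ w.2)
  refine (isClosed_convGraph ζ).mem_of_tendsto (h1.prodMk_nhds h2) (Eventually.of_forall fun K => ?_)
  exact convGraph_pseudofunction ζ ⟨_, hT (approximateUnit p μ K)⟩ hw

/-- The Bochner integral and the pointwise convolution are compared through their integrals over
sets of finite measure. The swap of integrals is the one for compactly supported continuous kernels,
which needs no σ-finiteness. -/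
theorem convGraph_ccLp (k ζ : C_c(G, ℂ)) :
    (leftConvolution p μ (ccLp 1 μ k) (ccLp p μ ζ), ccLp p μ k) ∈ convGraph p μ ζ := by
  have hp0 : p ≠ 0 := (zero_lt_one.trans_le (Fact.out : 1 ≤ p)).ne'
  set F : C_c(G, ℂ) := ⟨⟨rightConv (ccLp p μ k) ζ, continuous_rightConv _ _⟩,
    hasCompactSupport_rightConv k ζ⟩ with hF
  have hF' : ∀ x, F x = ∫ y, k y * ζ (y⁻¹ * x) ∂μ := by
    intro x
    refine integral_congr_ae ?_
    filter_upwards [coeFn_ccLp (p := p) (μ := μ) k] with y hy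
    rw [hy]
  suffices h : leftConvolution p μ (ccLp 1 μ k) (ccLp p μ ζ) =ᵐ[μ] ccLp p μ F by
    intro K _
    refine ae_restrict_of_ae ?_
    filter_upwards [h, coeFn_ccLp (p := p) (μ := μ) F] with x h1 h2
    rw [h1, h2]
    rfl
  refine Lp.ae_eq_of_forall_setIntegral_eq _ _ hp0 Fact.out ?_ ?_ ?_
  · exact fun E _ hμE => Lp.integrableOn_of_measure_lt_top _ hμE
  · exact fun E _ hμE => Lp.integrableOn_of_measure_lt_top _ hμE
  · intro E hE hμE
    have hmem : ∀ q, MemLp (E.indicator fun _ => (1 : ℂ)) q μ := fun q =>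
      memLp_indicator_const q hE 1 (Or.inr hμE.ne)
    obtain ⟨L, hL⟩ := exists_continuousLinearMap_integral_mul p hmem
    have hL' : ∀ h, L h = ∫ x in E, h x ∂μ := fun h => by
      rw [hL, ← integral_indicator hE]
      congr 1 with x
      by_cases hx : x ∈ E <;> simp [hx]
    rw [← hL', leftConvolution_apply,
      ← ContinuousLinearMap.integral_comp_comm _ (integrable_smul_leftRegular p μ _ _)]
    have h1 : ∀ s, L (leftRegular p μ s (ccLp p μ ζ)) = ∫ x in E, ζ (s⁻¹ * x) ∂μ := fun s => by
      rw [hL']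
      refine integral_congr_ae (ae_restrict_of_ae ?_)
      filter_upwards [leftRegular_coeFn p μ s (ccLp p μ ζ),
        (measurePreserving_mul_left μ s⁻¹).quasiMeasurePreserving.ae
          (coeFn_ccLp (p := p) (μ := μ) ζ)] with x h1 h2
      rw [h1, h2]
    have h2 : ∫ s, L (ccLp 1 μ k s • leftRegular p μ s (ccLp p μ ζ)) ∂μ
        = ∫ s, ∫ x in E, k s * ζ (s⁻¹ * x) ∂μ ∂μ := by
      refine integral_congr_ae ?_
      filter_upwards [coeFn_ccLp (p := 1) (μ := μ) k] with s hs
      rw [map_smul, h1, hs, smul_eq_mul, integral_const_mul]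
    rw [h2, integral_integral_swap_of_hasCompactSupport]
    · refine integral_congr_ae (ae_restrict_of_ae ?_)
      filter_upwards [coeFn_ccLp (p := p) (μ := μ) F] with x hx
      rw [hx, hF']
    · change Continuous fun q : G × G => k q.1 * ζ (q.1⁻¹ * q.2)
      fun_prop
    · refine HasCompactSupport.intro (K := tsupport k ×ˢ (tsupport k * tsupport ζ))
        (IsCompact.prod k.hasCompactSupport
          (IsCompact.mul k.hasCompactSupport ζ.hasCompactSupport)) fun q hq => ?_
      by_contra h0
      obtain ⟨h3, h4⟩ := mul_ne_zero_iff.1 h0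
      exact hq ⟨subset_tsupport _ h3, q.1, subset_tsupport _ h3, _, subset_tsupport _ h4, by simp⟩

end RightConvolutionHaar

/-! ### Pairs of continuous functions related by the isometry, and the translation point -/

section Intertwining

variable {G : Type*} [Group G] [TopologicalSpace G] [IsTopologicalGroup G]
  [MeasurableSpace G] [BorelSpace G] [LocallyCompactSpace G] [T2Space G] {p : ℝ≥0∞}
  [Fact (1 ≤ p)] [Fact (p ≠ ∞)] {μ : Measure G} [μ.IsHaarMeasure] [μ.InnerRegularCompactLTTop]

/-- Exceptional points lie where `u ≠ 0`, a set exhausted up to null sets by countably many compact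
sets; elsewhere `G` may be too large for such a passage. -/
theorem Lp.ae_of_forall_isCompact (u : Lp ℂ p μ) {P : G → Prop} (hP : ∀ x, u x = 0 → P x)
    (h : ∀ K, IsCompact K → ∀ᵐ x ∂μ.restrict K, P x) : ∀ᵐ x ∂μ, P x := by
  have hp0 : p ≠ 0 := (zero_lt_one.trans_le (Fact.out : 1 ≤ p)).ne'
  refine Lp.measure_zero_of_forall_isCompact hp0 Fact.out u (fun x hx hux => hx (hP x hux))
    fun K hK => ?_
  have := (ae_restrict_iff' hK.measurableSet).1 (h K hK)
  refine measure_mono_null (fun x hx => ?_) this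
  exact fun h' => hx.1 (h' hx.2)

/-- A property which holds almost everywhere in compact sets holds somewhere in each non-empty open
set. -/
theorem exists_of_ae_of_isOpen {P : G → Prop}
    (h : ∀ K, IsCompact K → ∀ᵐ x ∂μ.restrict K, P x) {O : Set G} (hO : IsOpen O) {x : G}
    (hx : x ∈ O) : ∃ y ∈ O, P y := by
  obtain ⟨K, hKx, hKO, hK⟩ := local_compact_nhds (hO.mem_nhds hx)
  by_contra! hP
  have h1 := (ae_restrict_iff' hK.measurableSet).1 (h K hK)
  refine (Measure.measure_pos_of_mem_nhds μ hKx).ne' (measure_mono_null (fun y hy => ?_) h1)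
  exact fun h' => hP y (hKO hy) (h' hy)

theorem RepresentedBy.ne_zero {u : Lp ℂ p μ} {f : G → ℂ} (h : RepresentedBy u f)
    (hf : Continuous f) {x : G} (hx : f x ≠ 0) : u ≠ 0 := by
  rintro rfl
  obtain ⟨y, hy, hy'⟩ := exists_of_ae_of_isOpen (μ := μ) (P := fun x => f x = 0) (fun K hK => by
    filter_upwards [h K hK, ae_restrict_of_ae (Lp.coeFn_zero ℂ p μ)] with y h1 h2
    rw [← h1, h2, Pi.zero_apply]) (isOpen_ne_fun hf continuous_const) hx
  exact hy hy'

theorem RepresentedBy.eq_zero {u : Lp ℂ p μ} (h : RepresentedBy u fun _ => 0) : u = 0 := by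
  refine Lp.ext ?_
  filter_upwards [Lp.ae_of_forall_isCompact u (fun _ h => h) h, Lp.coeFn_zero ℂ p μ] with x h1 h2
  rw [h1, h2, Pi.zero_apply]

theorem RepresentedBy.sub_smul {u v : Lp ℂ p μ} {f g : G → ℂ} (hu : RepresentedBy u f)
    (hv : RepresentedBy v g) (a b : ℂ) :
    RepresentedBy (a • u - b • v) fun x => a * f x - b * g x := by
  intro K hK
  filter_upwards [hu K hK, hv K hK, ae_restrict_of_ae (Lp.coeFn_sub (a • u) (b • v)),
    ae_restrict_of_ae (Lp.coeFn_smul a u), ae_restrict_of_ae (Lp.coeFn_smul b v)]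
    with x h1 h2 h3 h4 h5
  rw [h3, Pi.sub_apply, h4, h5, Pi.smul_apply, Pi.smul_apply, h1, h2, smul_eq_mul, smul_eq_mul]

/-- The isometry `T` maps each right translate of the continuous function `f` to the
corresponding right translate of the continuous function `F`. -/
structure Intertwines (T : Lp ℂ p μ →ₗᵢ[ℂ] Lp ℂ p μ) (f F : G → ℂ) : Prop where
  continuous_left : Continuous f
  continuous_right : Continuous F
  exists_representedBy : ∀ t, ∃ u : Lp ℂ p μ, RepresentedBy u (fun x => f (x * t)) ∧
    RepresentedBy (T u) (fun x => F (x * t))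

namespace Intertwines

variable {T : Lp ℂ p μ →ₗᵢ[ℂ] Lp ℂ p μ} {f F f' F' : G → ℂ}

theorem representedBy (h : Intertwines T f F) :
    ∃ u : Lp ℂ p μ, RepresentedBy u f ∧ RepresentedBy (T u) F := by
  simpa using h.exists_representedBy 1

theorem translate (h : Intertwines T f F) (t : G) :
    Intertwines T (fun x => f (x * t)) (fun x => F (x * t)) where
  continuous_left := h.continuous_left.comp (continuous_mul_const t)
  continuous_right := h.continuous_right.comp (continuous_mul_const t)
  exists_representedBy t' := by
    simpa only [mul_assoc] using h.exists_representedBy (t' * t)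

theorem sub_smul (h : Intertwines T f F) (h' : Intertwines T f' F') (a b : ℂ) :
    Intertwines T (fun x => a * f x - b * f' x) (fun x => a * F x - b * F' x) where
  continuous_left := (h.continuous_left.const_mul a).sub (h'.continuous_left.const_mul b)
  continuous_right := (h.continuous_right.const_mul a).sub (h'.continuous_right.const_mul b)
  exists_representedBy t := by
    obtain ⟨u, hu, hTu⟩ := h.exists_representedBy t
    obtain ⟨v, hv, hTv⟩ := h'.exists_representedBy t
    refine ⟨a • u - b • v, hu.sub_smul hv a b, ?_⟩
    rw [map_sub, map_smul, map_smul]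
    exact hTu.sub_smul hTv a b

/-- Disjointness of the images holds almost everywhere; by continuity a common nonzero value would
persist on a nonempty open set, so it holds at every point. -/
theorem disjoint (hp2 : p ≠ 2) (h : Intertwines T f F) (h' : Intertwines T f' F')
    (hd : ∀ z, f z = 0 ∨ f' z = 0) (x : G) : F x = 0 ∨ F' x = 0 := by
  obtain ⟨u, hu, hTu⟩ := h.representedBy
  obtain ⟨v, hv, hTv⟩ := h'.representedBy
  have h1 : ∀ᵐ x ∂μ, u x = 0 ∨ v x = 0 :=
    Lp.ae_of_forall_isCompact u (fun _ => Or.inl) fun K hK => by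
      filter_upwards [hu K hK, hv K hK] with x h1 h2
      rw [h1, h2]
      exact hd x
  have h2 := T.disjoint_of_disjoint Fact.out hp2 h1
  by_contra! hx
  obtain ⟨y, hy, hy'⟩ := exists_of_ae_of_isOpen (μ := μ) (P := fun x => F x = 0 ∨ F' x = 0)
    (fun K hK => by
      filter_upwards [hTu K hK, hTv K hK, ae_restrict_of_ae h2] with y h1 h2 h3
      rwa [← h1, ← h2])
    ((isOpen_ne_fun h.continuous_right continuous_const).inter
      (isOpen_ne_fun h'.continuous_right continuous_const)) (show x ∈ _ from hx)
  exact hy'.elim hy.1 hy.2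

/-- The right translation by `x⁻¹ * y` brings the nonzero value of `F'` from `y` to `x`, where
`disjoint` applies. The relative position of points in the images is thus visible in the originals.
-/
theorem exists_of_ne_zero (hp2 : p ≠ 2) (h : Intertwines T f F) (h' : Intertwines T f' F')
    {x y : G} (hx : F x ≠ 0) (hy : F' y ≠ 0) : ∃ z, f z ≠ 0 ∧ f' (z * x⁻¹ * y) ≠ 0 := by
  by_contra! hz
  have := h.disjoint hp2 (h'.translate (x⁻¹ * y)) (fun z => by
    rw [← mul_assoc]
    exact or_iff_not_imp_left.2 (hz z)) x
  rw [mul_inv_cancel_left] at this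
  exact this.elim hx hy

theorem exists_ne_zero (h : Intertwines T f F) {x : G} (hx : f x ≠ 0) : ∃ y, F y ≠ 0 := by
  by_contra! hF
  obtain ⟨u, hu, hTu⟩ := h.representedBy
  obtain rfl : F = fun _ => 0 := funext hF
  have h0 := hTu.eq_zero
  exact hu.ne_zero h.continuous_left hx (T.injective (h0.trans (map_zero T).symm))

end Intertwines

/-- The left multiplication by `T` maps pseudofunctions to pseudofunctions. -/
def IsPseudofunctionMultiplier (T : Lp ℂ p μ →ₗᵢ[ℂ] Lp ℂ p μ) : Prop :=
  ∀ a : pseudofunctions p μ, T.toContinuousLinearMap * a ∈ pseudofunctions p μ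

variable {T : Lp ℂ p μ →ₗᵢ[ℂ] Lp ℂ p μ}

theorem IsPseudofunctionMultiplier.intertwines (hT : IsPseudofunctionMultiplier T)
    (k ζ : C_c(G, ℂ)) :
    Intertwines T (rightConv (ccLp p μ k) ζ) (rightConv (T (ccLp p μ k)) ζ) where
  continuous_left := continuous_rightConv _ _
  continuous_right := continuous_rightConv _ _
  exists_representedBy t := by
    have h := convGraph_ccLp (p := p) (μ := μ) k (rightTranslate ζ t)
    refine ⟨leftConvolution p μ (ccLp 1 μ k) (ccLp p μ (rightTranslate ζ t)), ?_, ?_⟩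
    · simpa only [mem_convGraph, RepresentedBy, rightConv_rightTranslate]
        using mem_convGraph.1 h
    · simpa only [mem_convGraph, RepresentedBy, rightConv_rightTranslate,
        LinearIsometry.coe_toContinuousLinearMap] using
        mem_convGraph.1 (convGraph_multiplier _ hT h)

theorem exists_cc_one (W : Set G) (hW : W ∈ 𝓝 (1 : G)) :
    ∃ φ : C(G, ℝ), HasCompactSupport φ ∧ φ 1 = 1 ∧ (∀ x, 0 ≤ φ x) ∧ ∀ x, φ x ≠ 0 → x ∈ W := by
  obtain ⟨φ, h1, hc, hs, h01⟩ := exists_continuousMap_one_of_isCompact_subset_isOpen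
    (isCompact_singleton (x := (1 : G))) isOpen_interior
    (Set.singleton_subset_iff.2 (mem_interior_iff_mem_nhds.2 hW))
  exact ⟨φ, hc, h1 rfl, fun x => (h01 x).1,
    fun x hx => interior_subset (hs (subset_tsupport _ hx))⟩

/-- Convolve a nonnegative bump on `V` with itself, where `V * V ⊆ W`. At `1` the integrand is
nonnegative, and equals `1` at `y = 1`. -/
theorem exists_rightConv_bump (p : ℝ≥0∞) (μ : Measure G) [μ.IsHaarMeasure]
    {W : Set G} (hW : W ∈ 𝓝 (1 : G)) : ∃ k ζ : C_c(G, ℂ),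
    rightConv (ccLp p μ k) ζ 1 ≠ 0 ∧ ∀ x, rightConv (ccLp p μ k) ζ x ≠ 0 → x ∈ W := by
  obtain ⟨V, hVo, hV1, hVW⟩ := exists_open_nhds_one_mul_subset hW
  obtain ⟨φ, hφc, hφ1, hφ0, hφV⟩ := exists_cc_one V (hVo.mem_nhds hV1)
  let k : C_c(G, ℂ) := ⟨⟨fun x => (φ x : ℂ), by fun_prop⟩,
    HasCompactSupport.comp_left (g := fun t : ℝ => (t : ℂ)) hφc (by simp)⟩
  have hk : ∀ x, rightConv (ccLp p μ k) k x = ((∫ y, φ y * φ (y⁻¹ * x) ∂μ : ℝ) : ℂ) := by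
    intro x
    rw [← integral_complex_ofReal]
    refine integral_congr_ae ?_
    filter_upwards [coeFn_ccLp (p := p) (μ := μ) k] with y hy
    rw [hy, Complex.ofReal_mul]
    rfl
  refine ⟨k, k, ?_, fun x hx => ?_⟩
  · rw [hk, Complex.ofReal_ne_zero]
    have hc : Continuous fun y : G => φ y * φ (y⁻¹ * 1) := by fun_prop
    refine (hc.integral_pos_of_hasCompactSupport_nonneg_nonzero (x := 1) ?_ ?_ ?_).ne'
    · exact HasCompactSupport.mul_right hφc
    · exact fun y => mul_nonneg (hφ0 _) (hφ0 _)
    · simp [hφ1]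
  · by_contra hxW
    refine hx ?_
    rw [hk, Complex.ofReal_eq_zero]
    refine integral_eq_zero_of_ae (Eventually.of_forall fun y => ?_)
    by_contra h0
    obtain ⟨h1, h2⟩ := mul_ne_zero_iff.1 h0
    refine hxW (hVW ⟨y, hφV _ h1, _, hφV _ h2, by simp⟩)

theorem IsPseudofunctionMultiplier.exists_bump (hT : IsPseudofunctionMultiplier T)
    {W : Set G} (hW : W ∈ 𝓝 (1 : G)) :
    ∃ (f F : G → ℂ) (x : G), Intertwines T f F ∧ f 1 ≠ 0 ∧ (∀ z, f z ≠ 0 → z ∈ W) ∧ F x ≠ 0 := by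
  obtain ⟨k, ζ, h1, hW⟩ := exists_rightConv_bump p μ hW
  obtain ⟨x, hx⟩ := (hT.intertwines k ζ).exists_ne_zero h1
  exact ⟨_, _, x, hT.intertwines k ζ, h1, hW, hx⟩

/-- An isometric multiplier moves supports by a left translation. -/
theorem IsPseudofunctionMultiplier.exists_translation (hp2 : p ≠ 2)
    (hT : IsPseudofunctionMultiplier T) :
    ∃ s : G, ∀ f F : G → ℂ, Intertwines T f F → ∀ x, F x ≠ 0 → s⁻¹ * x ∈ closure {z | f z ≠ 0} := by
  have hex : ∀ K : Set G, ∃ (f F : G → ℂ) (x : G), K ∈ 𝓝 (1 : G) →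
      Intertwines T f F ∧ (∀ z, f z ≠ 0 → z ∈ K) ∧ F x ≠ 0 := by
    intro K
    by_cases hK : K ∈ 𝓝 (1 : G)
    · obtain ⟨f, F, x, h1, -, h2, h3⟩ := hT.exists_bump hK
      exact ⟨f, F, x, fun _ => ⟨h1, h2, h3⟩⟩
    · exact ⟨0, 0, 1, fun h => absurd h hK⟩
  choose f F x hfF using hex
  obtain ⟨K₀, hK₀c, hK₀⟩ := exists_compact_mem_nhds (1 : G)
  -- Comparing the bump for `K` with the fixed one for `K₀` confines the points `x K` to a compact
  -- set, so an ultrafilter limit `s` exists.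
  have hx : ∀ᶠ K in smallCompactNhds (1 : G), x K ∈ ({x K₀} : Set G) * (K₀⁻¹ * K₀) := by
    filter_upwards [eventually_smallCompactNhds (1 : G), eventually_subset_smallCompactNhds hK₀]
      with K hK hKK₀
    obtain ⟨z, hz, hz'⟩ := (hfF K₀ hK₀).1.exists_of_ne_zero hp2 (hfF K hK.2).1
      (hfF K₀ hK₀).2.2 (hfF K hK.2).2.2
    refine ⟨x K₀, rfl, (x K₀)⁻¹ * x K, ⟨z⁻¹, Set.inv_mem_inv.2 ((hfF K₀ hK₀).2.1 z hz),
      z * (x K₀)⁻¹ * x K, hKK₀ ((hfF K hK.2).2.1 _ hz'), ?_⟩, ?_⟩ <;> simp [mul_assoc]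
  let U := Ultrafilter.of (smallCompactNhds (1 : G))
  have hU : (U : Filter (Set G)) ≤ smallCompactNhds (1 : G) := Ultrafilter.of_le _
  obtain ⟨s, -, hs⟩ := (isCompact_singleton.mul (hK₀c.inv.mul hK₀c)).ultrafilter_le_nhds' (U.map x)
    (hU hx)
  refine ⟨s, fun f' F' hfF' y hy => ?_⟩
  -- Now compare an arbitrary pair with the bumps: `z * y⁻¹ * x K` tends to `1` and `x K` to `s`, so
  -- `z` tends to `s⁻¹ * y` within the set where `f' ≠ 0`.
  have hex : ∀ K : Set G, ∃ z, K ∈ 𝓝 (1 : G) → f' z ≠ 0 ∧ z * y⁻¹ * x K ∈ K := by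
    intro K
    by_cases hK : K ∈ 𝓝 (1 : G)
    · obtain ⟨z, hz, hz'⟩ := hfF'.exists_of_ne_zero hp2 (hfF K hK).1 hy (hfF K hK).2.2
      exact ⟨z, fun _ => ⟨hz, (hfF K hK).2.1 _ hz'⟩⟩
    · exact ⟨1, fun h => absurd h hK⟩
  choose z hz using hex
  have h1 : Tendsto (fun K => z K * y⁻¹ * x K) U (𝓝 1) := by
    refine Tendsto.mono_left (fun V hV => mem_map.2 ?_) hU
    filter_upwards [eventually_smallCompactNhds (1 : G), eventually_subset_smallCompactNhds hV]
      with K hK hKV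
    exact hKV (hz K hK.2).2
  have h2 : Tendsto x U (𝓝 s) := hs
  have h3 : Tendsto z U (𝓝 (s⁻¹ * y)) := by
    have := (h1.mul h2.inv).mul_const y
    simpa [mul_assoc] using this
  refine mem_closure_of_tendsto h3 (hU ?_)
  filter_upwards [eventually_smallCompactNhds (1 : G)] with K hK
  exact (hz K hK.2).1

end Intertwining

/-! ### Local isometric multipliers are scalars -/

section Locality

variable {G : Type*} [Group G] [TopologicalSpace G] [IsTopologicalGroup G]
  [MeasurableSpace G] [BorelSpace G] [LocallyCompactSpace G] [T2Space G] {p : ℝ≥0∞}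
  [Fact (1 ≤ p)] [Fact (p ≠ ∞)] {μ : Measure G} [μ.IsHaarMeasure] [μ.InnerRegularCompactLTTop]
  {T : Lp ℂ p μ →ₗᵢ[ℂ] Lp ℂ p μ}

/-- The isometry `T` does not enlarge supports. -/
def IsLocalIsometry (T : Lp ℂ p μ →ₗᵢ[ℂ] Lp ℂ p μ) : Prop :=
  ∀ f F : G → ℂ, Intertwines T f F → ∀ x, F x ≠ 0 → x ∈ closure {z | f z ≠ 0}

/-- A bump near `1` has, by locality, an image that is nonzero at some `x` near `1`; a right
translation carries `x` to `y`. The set `V` is closed because locality only places `x` in the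
closure of the support. -/
theorem IsPseudofunctionMultiplier.exists_bump_at (hT : IsPseudofunctionMultiplier T)
    (hloc : IsLocalIsometry T) {U : Set G} {y : G} (hU : U ∈ 𝓝 y) :
    ∃ f F : G → ℂ, Intertwines T f F ∧ (∀ z, f z ≠ 0 → z ∈ U) ∧ F y ≠ 0 := by
  have hc : Tendsto (fun w : G × G => w.1 * w.2⁻¹ * y) (𝓝 (1, 1)) (𝓝 y) := by
    have h : Continuous fun w : G × G => w.1 * w.2⁻¹ * y := by fun_prop
    simpa using h.tendsto (1, 1)
  have h1 := hc hU
  rw [nhds_prod_eq] at h1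
  obtain ⟨W, hW, hWU⟩ := mem_prod_same_iff.1 (mem_map.1 h1)
  obtain ⟨V, hV, hVc, hVW⟩ := exists_mem_nhds_isClosed_subset hW
  obtain ⟨f, F, x, hfF, -, hfV, hx⟩ := hT.exists_bump hV
  have hxV : x ∈ V := hVc.closure_subset_iff.2 (fun z hz => hfV z hz) (hloc f F hfF x hx)
  refine ⟨_, _, hfF.translate (y⁻¹ * x), fun z hz => ?_, by simpa using hx⟩
  have := hWU (show ((z * (y⁻¹ * x), x) : G × G) ∈ W ×ˢ W from ⟨hVW (hfV _ hz), hVW hxV⟩)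
  simpa [mul_assoc] using this

/-- If `u` vanishes in an open set then so does `T u`. -/
theorem IsPseudofunctionMultiplier.ae_restrict_eq_zero (hp2 : p ≠ 2)
    (hT : IsPseudofunctionMultiplier T) (hloc : IsLocalIsometry T) {U : Set G} (hU : IsOpen U)
    {u : Lp ℂ p μ} (hu : ∀ᵐ x ∂μ, x ∈ U → u x = 0) {K : Set G} (hK : IsCompact K) (hKU : K ⊆ U) :
    ∀ᵐ x ∂μ.restrict K, T u x = 0 := by
  refine hK.induction_on (p := fun s => ∀ᵐ x ∂μ.restrict s, T u x = 0) (by simp)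
    (fun s t hst ht => ae_restrict_of_ae_restrict_of_subset hst ht)
    (fun s t hs ht => (ae_restrict_union_iff s t _).2 ⟨hs, ht⟩) fun y hy => ?_
  -- The test function `f` lives in `U`, so it is disjoint from `u`; hence `T u` must vanish where
  -- `F ≠ 0`, in particular near `y`.
  obtain ⟨f, F, hfF, hfU, hFy⟩ := hT.exists_bump_at hloc (hU.mem_nhds (hKU hy))
  obtain ⟨v, hv, hTv⟩ := hfF.representedBy
  have h1 : ∀ᵐ x ∂μ, v x = 0 ∨ u x = 0 :=
    Lp.ae_of_forall_isCompact v (fun _ => Or.inl) fun L hL => by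
      filter_upwards [hv L hL, ae_restrict_of_ae hu] with x h1 h2
      rw [h1]
      exact or_iff_not_imp_left.2 fun h3 => h2 (hfU x h3)
  have h2 := T.disjoint_of_disjoint Fact.out hp2 h1
  obtain ⟨N, hNy, hNF, hN⟩ := local_compact_nhds
    ((isOpen_ne_fun hfF.continuous_right continuous_const).mem_nhds hFy)
  refine ⟨N, mem_nhdsWithin_of_mem_nhds hNy, ?_⟩
  filter_upwards [ae_restrict_of_ae h2, hTv N hN, ae_restrict_mem hN.measurableSet] with x h3 h4 h5
  exact h3.resolve_left fun h => hNF h5 (by rw [← h4, h])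

/-- If `H 1 ≠ 0`, then near `1` the function `g` is much smaller than `H`. Cutting `u` off to a
small `U` does not change its image on compact `K ⊆ U`, by locality, so the norm of the cut-off
would grow under `T`. -/
theorem IsPseudofunctionMultiplier.apply_one_eq_zero (hp2 : p ≠ 2)
    (hT : IsPseudofunctionMultiplier T) (hloc : IsLocalIsometry T) {g H : G → ℂ}
    (h : Intertwines T g H) (hg : g 1 = 0) : H 1 = 0 := by
  have hp0 : p ≠ 0 := (zero_lt_one.trans_le (Fact.out : 1 ≤ p)).ne'
  have hptop : p ≠ ∞ := Fact.out
  by_contra hH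
  set c : ℝ := ‖H 1‖ / 2 with hc
  have hHpos : 0 < ‖H 1‖ := norm_pos_iff.2 hH
  have hcpos : 0 < c := by positivity
  obtain ⟨u, hu, hTu⟩ := h.representedBy
  obtain ⟨L, hL, hL1⟩ := exists_compact_mem_nhds (1 : G)
  -- The factor `3` between the two bounds beats the factor `2 ^ (1 / p) ≤ 2` lost in passing from
  -- `U` to a compact `K` with more than half its measure.
  let U : Set G := interior L ∩ ({x | ‖g x‖ < c / 3} ∩ {x | c < ‖H x‖})
  have hUo : IsOpen U := isOpen_interior.inter
    ((isOpen_lt h.continuous_left.norm continuous_const).inter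
      (isOpen_lt continuous_const h.continuous_right.norm))
  have hU1 : (1 : G) ∈ U := by
    refine ⟨mem_interior_iff_mem_nhds.2 hL1, ?_, ?_⟩
    · change ‖g 1‖ < c / 3
      rw [hg, norm_zero]
      positivity
    · exact half_lt_self hHpos
  have hUL : U ⊆ L := fun x hx => interior_subset hx.1
  have hUtop : μ U ≠ ∞ := (lt_of_le_of_lt (measure_mono hUL) hL.measure_lt_top).ne
  have hUpos : μ U ≠ 0 := (hUo.measure_pos μ ⟨1, hU1⟩).ne'
  obtain ⟨K, hKU, hK, hμK⟩ := hUo.measurableSet.exists_lt_isCompact_of_ne_top hUtop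
    (ENNReal.half_lt_self hUpos hUtop)
  have hmem := (Lp.memLp u).indicator hUo.measurableSet
  set u₁ : Lp ℂ p μ := hmem.toLp _ with hu₁
  have hu₁' : u₁ =ᵐ[μ] U.indicator u := hmem.coeFn_toLp
  have hdiff : ∀ᵐ x ∂μ, x ∈ U → (u - u₁) x = 0 := by
    filter_upwards [hu₁', Lp.coeFn_sub u u₁] with x h1 h2 hx
    rw [h2, Pi.sub_apply, h1, Set.indicator_of_mem hx, sub_self]
  have hzero := hT.ae_restrict_eq_zero hp2 hloc hUo hdiff hK hKU
  have hKtop : μ K ≠ ∞ := hK.measure_lt_top.ne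
  have hle1 : ‖u₁‖ ≤ ‖indicatorConstLp p hUo.measurableSet hUtop ((c / 3 : ℝ) : ℂ)‖ := by
    refine Lp.norm_le_norm_of_ae_le ?_
    filter_upwards [hu₁', indicatorConstLp_coeFn (p := p) (hs := hUo.measurableSet)
      (hμs := hUtop) (c := ((c / 3 : ℝ) : ℂ)), (ae_restrict_iff' hL.measurableSet).1 (hu L hL)]
      with x h1 h2 h3
    rw [h1, h2]
    by_cases hx : x ∈ U
    · rw [Set.indicator_of_mem hx, Set.indicator_of_mem hx, h3 (hUL hx), Complex.norm_real,
        Real.norm_of_nonneg (by positivity)]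
      exact hx.2.1.le
    · simp [hx]
  have hle2 : ‖indicatorConstLp p hK.measurableSet hKtop (c : ℂ)‖ ≤ ‖T u₁‖ := by
    refine Lp.norm_le_norm_of_ae_le ?_
    have hsub : T (u - u₁) = T u - T u₁ := map_sub T u u₁
    rw [hsub] at hzero
    filter_upwards [indicatorConstLp_coeFn (p := p) (hs := hK.measurableSet) (hμs := hKtop)
      (c := (c : ℂ)), (ae_restrict_iff' hK.measurableSet).1 hzero,
      (ae_restrict_iff' hK.measurableSet).1 (hTu K hK), Lp.coeFn_sub (T u) (T u₁)]
      with x h1 h2 h3 h4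
    rw [h1]
    by_cases hx : x ∈ K
    · have h5 := h2 hx
      rw [h4, Pi.sub_apply, sub_eq_zero, h3 hx] at h5
      rw [Set.indicator_of_mem hx, ← h5, Complex.norm_real, Real.norm_of_nonneg hcpos.le]
      exact (hKU hx).2.2.le
    · simp [hx]
  rw [T.norm_map] at hle2
  have hle := hle2.trans hle1
  rw [norm_indicatorConstLp hp0 hptop, norm_indicatorConstLp hp0 hptop, Complex.norm_real,
    Complex.norm_real, Real.norm_of_nonneg hcpos.le, Real.norm_of_nonneg (by positivity)] at hle
  have hr : 1 / p.toReal ≤ 1 := by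
    have : 1 ≤ p.toReal := by
      rw [← ENNReal.toReal_one]
      exact ENNReal.toReal_mono hptop Fact.out
    exact (div_le_one (by linarith)).2 this
  have hr0 : 0 ≤ 1 / p.toReal := by positivity
  have hUK : μ.real U ≤ 2 * μ.real K := by
    have h1 := ENNReal.toReal_mono hKtop hμK.le
    rw [ENNReal.toReal_div, ENNReal.toReal_ofNat] at h1
    change (μ U).toReal ≤ 2 * (μ K).toReal
    linarith
  have hKpos : 0 < μ.real K := by
    have : 0 < μ.real U := ENNReal.toReal_pos hUpos hUtop
    linarith
  have h1 : μ.real U ^ (1 / p.toReal) ≤ 2 * μ.real K ^ (1 / p.toReal) := by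
    calc μ.real U ^ (1 / p.toReal) ≤ (2 * μ.real K) ^ (1 / p.toReal) :=
          Real.rpow_le_rpow measureReal_nonneg hUK hr0
      _ = 2 ^ (1 / p.toReal) * μ.real K ^ (1 / p.toReal) :=
          Real.mul_rpow zero_le_two hKpos.le
      _ ≤ 2 * μ.real K ^ (1 / p.toReal) := by
          gcongr
          calc (2 : ℝ) ^ (1 / p.toReal) ≤ 2 ^ (1 : ℝ) :=
                Real.rpow_le_rpow_of_exponent_le one_le_two hr
            _ = 2 := Real.rpow_one 2
  have h2 : 0 < μ.real K ^ (1 / p.toReal) := Real.rpow_pos_of_pos hKpos _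
  have h3 : c / 3 * μ.real U ^ (1 / p.toReal) ≤ c / 3 * (2 * μ.real K ^ (1 / p.toReal)) :=
    mul_le_mul_of_nonneg_left h1 (by positivity)
  have h4 : 0 < c * μ.real K ^ (1 / p.toReal) := mul_pos hcpos h2
  nlinarith

/-- A local isometric multiplier is a scalar. -/
theorem IsPseudofunctionMultiplier.exists_eq_smul_of_isLocalIsometry (hp2 : p ≠ 2)
    (hT : IsPseudofunctionMultiplier T) (hloc : IsLocalIsometry T) :
    ∃ c : ℂ, ∀ ξ, T ξ = c • ξ := by
  obtain ⟨e, E, -, heE, he, -, -⟩ := hT.exists_bump (W := Set.univ) univ_mem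
  have h1 : ∀ f F, Intertwines T f F → F 1 = E 1 / e 1 * f 1 := by
    intro f F hfF
    -- The combination `e 1 • f - f 1 • e` vanishes at `1`, so its image does too; this determines
    -- `F 1` from the reference pair `(e, E)`.
    have := hT.apply_one_eq_zero hp2 hloc (hfF.sub_smul heE (e 1) (f 1)) (by ring)
    field_simp
    linear_combination this
  have h2 : ∀ f F, Intertwines T f F → ∀ x, F x = E 1 / e 1 * f x := by
    intro f F hfF x
    simpa using h1 _ _ (hfF.translate x)
  refine ⟨E 1 / e 1, ?_⟩
  set c := E 1 / e 1
  have h3 : ∀ k ζ : C_c(G, ℂ), T (leftConvolution p μ (ccLp 1 μ k) (ccLp p μ ζ))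
      = c • leftConvolution p μ (ccLp 1 μ k) (ccLp p μ ζ) := by
    intro k ζ
    have h := convGraph_ccLp (p := p) (μ := μ) k ζ
    have h' := (mem_convGraph.1 (convGraph_multiplier _ hT h)).sub_smul (mem_convGraph.1 h) 1 c
    rw [← sub_eq_zero, ← one_smul ℂ (T _)]
    refine RepresentedBy.eq_zero (Eq.mp ?_ h')
    congr 1
    funext x
    have := h2 _ _ (hT.intertwines k ζ) x
    change 1 * rightConv (T (ccLp p μ k)) ζ x - _ = 0
    rw [this]
    ring
  have : Fact ((1 : ℝ≥0∞) ≠ ∞) := ⟨ENNReal.one_ne_top⟩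
  let D : Lp ℂ p μ →L[ℂ] Lp ℂ p μ := T.toContinuousLinearMap - c • ContinuousLinearMap.id ℂ _
  have hD : ∀ ξ, D ξ = T ξ - c • ξ := fun ξ => rfl
  -- Density of `C_c` in `L¹` removes the restriction on the left factor; averaging kernels then
  -- remove that factor, and density in `L^p` reaches every vector.
  have h4 : ∀ (ζ : C_c(G, ℂ)) (f : Lp ℂ 1 μ), D (leftConvolution p μ f (ccLp p μ ζ)) = 0 := by
    intro ζ
    let Φ := D ∘L (leftConvolution p μ).flip (ccLp p μ ζ)
    refine Lp.mem_of_forall_ccLp_mem ENNReal.one_ne_top (LinearMap.ker Φ.toLinearMap)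
      Φ.isClosed_ker fun k => ?_
    change D (leftConvolution p μ (ccLp 1 μ k) (ccLp p μ ζ)) = 0
    rw [hD, h3, sub_self]
  have h5 : ∀ ζ : C_c(G, ℂ), D (ccLp p μ ζ) = 0 := by
    intro ζ
    refine tendsto_nhds_unique ((D.continuous.tendsto _).comp
      (tendsto_leftConvolution_averagingKernel p μ (ccLp p μ ζ))) ?_
    refine tendsto_const_nhds.congr fun K => (h4 ζ _).symm
  intro ξ
  have h6 : ξ ∈ LinearMap.ker D.toLinearMap :=
    Lp.mem_of_forall_ccLp_mem Fact.out _ D.isClosed_ker h5 ξ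
  exact sub_eq_zero.1 h6

end Locality

/-! ### Classification of isometric multipliers -/

section Classification

variable {G : Type*} [Group G] [TopologicalSpace G] [IsTopologicalGroup G]
  [MeasurableSpace G] [BorelSpace G] [LocallyCompactSpace G] [T2Space G] (p : ℝ≥0∞)
  [Fact (1 ≤ p)] [Fact (p ≠ ∞)] (μ : Measure G) [μ.IsHaarMeasure] [μ.InnerRegularCompactLTTop]

theorem leftRegular_comp_leftConvolution (s : G) (f : Lp ℂ 1 μ) :
    leftRegular p μ s * leftConvolution p μ f = leftConvolution p μ (leftRegular 1 μ s f) := by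
  ext1 ξ
  change leftRegular p μ s (leftConvolution p μ f ξ) = _
  rw [leftConvolution_apply, leftConvolution_apply,
    ← ContinuousLinearMap.integral_comp_comm _ (integrable_smul_leftRegular p μ f ξ),
    ← integral_mul_left_eq_self (fun t => (leftRegular 1 μ s f) t • leftRegular p μ t ξ) s]
  refine integral_congr_ae ?_
  filter_upwards [(measurePreserving_mul_left μ s).quasiMeasurePreserving.ae_eq_comp
    (leftRegular_coeFn 1 μ s f)] with t ht
  simp only [Function.comp_apply, inv_mul_cancel_left] at ht
  rw [ht, map_smul, leftRegular_mul_apply]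

theorem leftRegular_mul_mem (s : G) (a : pseudofunctions p μ) :
    leftRegular p μ s * a ∈ pseudofunctions p μ := by
  refine pseudofunctions_induction p μ (P := fun a => leftRegular p μ s * a ∈ pseudofunctions p μ)
    ?_ (fun f => ?_) a
  · exact (NonUnitalSubalgebra.isClosed_topologicalClosure _).preimage
      (continuous_const_mul (leftRegular p μ s))
  · rw [leftRegular_comp_leftConvolution]
    exact leftConvolution_mem p μ _

/-- The left regular representation as a linear isometry. -/
noncomputable def leftRegularIsometry (s : G) : Lp ℂ p μ →ₗᵢ[ℂ] Lp ℂ p μ :=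
  ⟨(leftRegular p μ s).toLinearMap, norm_leftRegular_apply p μ s⟩

variable {p μ}

/-- The isometric multipliers of `PF_p(G)` are the scalar multiples of left translations. -/
theorem IsPseudofunctionMultiplier.exists_eq_smul_leftRegular (hp2 : p ≠ 2)
    {T : Lp ℂ p μ →ₗᵢ[ℂ] Lp ℂ p μ} (hT : IsPseudofunctionMultiplier T) :
    ∃ (c : ℂ) (s : G), ∀ ξ, T ξ = c • leftRegular p μ s ξ := by
  obtain ⟨s, hs⟩ := hT.exists_translation hp2
  have hinv : ∀ ξ, leftRegular p μ s (leftRegular p μ s⁻¹ ξ) = ξ := fun ξ => by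
    rw [← leftRegular_mul_apply, mul_inv_cancel, leftRegular_one, one_apply_eq_self]
  let T₁ : Lp ℂ p μ →ₗᵢ[ℂ] Lp ℂ p μ := (leftRegularIsometry p μ s⁻¹).comp T
  have hT₁ : ∀ ξ, T₁ ξ = leftRegular p μ s⁻¹ (T ξ) := fun ξ => rfl
  have h1 : IsPseudofunctionMultiplier T₁ := fun a =>
    leftRegular_mul_mem p μ s⁻¹ ⟨_, hT a⟩
  -- If `T₁` intertwines `f` and `F`, then `T` intertwines `f` and the left translate of `F` by `s`,
  -- so the displacement by `s` cancels.
  have h2 : IsLocalIsometry T₁ := by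
    intro f F hfF x hx
    have h3 : Intertwines T f fun x => F (s⁻¹ * x) :=
      { continuous_left := hfF.continuous_left
        continuous_right := hfF.continuous_right.comp (continuous_const_mul _)
        exists_representedBy := fun t => by
          obtain ⟨u, hu, hTu⟩ := hfF.exists_representedBy t
          refine ⟨u, hu, ?_⟩
          have h4 := hTu.leftRegular s
          rw [hT₁, hinv] at h4
          simpa only [mul_assoc] using h4 }
    have h4 := hs f _ h3 (s * x) (by simpa using hx)
    rwa [inv_mul_cancel_left] at h4
  obtain ⟨c, hc⟩ := h1.exists_eq_smul_of_isLocalIsometry hp2 h2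
  refine ⟨c, s, fun ξ => ?_⟩
  rw [← map_smul, ← hc, hT₁, hinv]

end Classification

/-! ### Strict topology and norm components for a general algebra -/

section AbstractMultipliers

variable {A : Type*} [NonUnitalNormedRing A] [NormedSpace ℂ A] [IsScalarTower ℂ A A]

namespace StrictMultiplierIsometries

/-- An element of `𝒰(M_l(A))` as an element of the multiplier algebra. -/
def toMultiplier (u : StrictMultiplierIsometries A) : leftMultiplierAlgebra A :=
  ((show invertibleIsometries (leftMultiplierAlgebra A) from u) : (leftMultiplierAlgebra A)ˣ)

theorem toMultiplier_injective :
    Function.Injective (toMultiplier : StrictMultiplierIsometries A → leftMultiplierAlgebra A) :=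
  fun _ _ h => Subtype.ext (Units.ext h)

theorem toOperator_injective :
    Function.Injective (toOperator : StrictMultiplierIsometries A → A →L[ℂ] A) :=
  fun _ _ h => toMultiplier_injective (Subtype.ext h)

theorem toOperator_apply_mul (u : StrictMultiplierIsometries A) (a b : A) :
    u.toOperator (a * b) = u.toOperator a * b :=
  u.toMultiplier.2 a b

theorem mul_toOperator_apply (u v : StrictMultiplierIsometries A) (a : A) :
    (u * v).toOperator a = u.toOperator (v.toOperator a) := rfl

theorem one_toOperator_apply (a : A) :
    (1 : StrictMultiplierIsometries A).toOperator a = a := rfl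

theorem norm_toOperator_apply_le (u : StrictMultiplierIsometries A) (a : A) :
    ‖u.toOperator a‖ ≤ ‖a‖ := by
  have h : ‖u.toMultiplier * 1‖ = ‖(1 : leftMultiplierAlgebra A)‖ :=
    (show invertibleIsometries (leftMultiplierAlgebra A) from u).2 1
  rw [mul_one] at h
  have h1 : ‖u.toOperator‖ ≤ 1 := h.le.trans ContinuousLinearMap.norm_id_le
  simpa using u.toOperator.le_of_opNorm_le h1 a

theorem inv_toOperator_apply (u : StrictMultiplierIsometries A) (a : A) :
    u⁻¹.toOperator (u.toOperator a) = a := by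
  rw [← mul_toOperator_apply, inv_mul_cancel, one_toOperator_apply]

/-- A group homomorphism into `𝒰(M_l(A))` from an isometric action by left multipliers. -/
noncomputable def ofAction {H : Type*} [Group H] (ρ : H →* (A →L[ℂ] A))
    (hmul : ∀ h a b, ρ h (a * b) = ρ h a * b) (hnorm : ∀ h a, ‖ρ h a‖ = ‖a‖) :
    H →* StrictMultiplierIsometries A :=
  MonoidHom.codRestrict (MonoidHom.toHomUnits
    (MonoidHom.codRestrict ρ (leftMultiplierAlgebra A) fun h => hmul h))
    (invertibleIsometries (leftMultiplierAlgebra A)) fun h b =>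
      ContinuousLinearMap.opNorm_ext _ _ fun a => hnorm h (b.1 a)

theorem continuous_iff {X : Type*} [TopologicalSpace X] {f : X → StrictMultiplierIsometries A} :
    Continuous f ↔ ∀ a, Continuous fun x => (f x).toOperator a := by
  rw [continuous_induced_rng, continuous_pi_iff]
  rfl

theorem continuous_toOperator_apply (a : A) :
    Continuous fun u : StrictMultiplierIsometries A => u.toOperator a :=
  continuous_iff.1 continuous_id a

/-- Continuity at `u` reduces to the unit: if `v → u` strictly, then `u⁻¹ v → 1` strictly because
the operator of `u⁻¹` is continuous on `A`. Only `H` needs to be known as a topological group. -/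
theorem continuous_symm {H : Type*} [Group H] [TopologicalSpace H] [IsTopologicalGroup H]
    (e : H ≃* StrictMultiplierIsometries A)
    (h : ∀ l : Filter H, (∀ a, Tendsto (fun w => (e w).toOperator a) l (𝓝 a)) → l ≤ 𝓝 1) :
    Continuous e.symm := by
  refine continuous_iff_continuousAt.2 fun u => ?_
  have h1 : Tendsto (fun v => (e.symm u)⁻¹ * e.symm v) (𝓝 u) (𝓝 1) := by
    refine h _ fun a => ?_
    rw [tendsto_map'_iff]
    have h3 := ((u⁻¹).toOperator.continuous.tendsto _).comp
      ((continuous_toOperator_apply a).tendsto u)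
    rw [u.inv_toOperator_apply] at h3
    refine h3.congr fun v => ?_
    rw [Function.comp_apply, Function.comp_apply, map_mul, map_inv, e.apply_symm_apply,
      e.apply_symm_apply, mul_toOperator_apply]
  have h4 := h1.const_mul (e.symm u)
  rw [mul_one] at h4
  exact h4.congr fun v => mul_inv_cancel_left _ _

end StrictMultiplierIsometries

open StrictMultiplierIsometries

/-- The component of `1` in `𝒰(M_l(A))`, if `𝒰(M_l(A))` is the product of the scalars and
a group which is discrete in the norm. -/
theorem mk_eq_one_iff_of_norm_gap {H : Type*} [Group H]
    (Λ : Circle × H ≃* StrictMultiplierIsometries A)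
    (hscalar : ∀ (γ : Circle) (a : A), (Λ (γ, 1)).toOperator a = (γ : ℂ) • a)
    (hgap : ∀ (γ : Circle) (s : H), (∃ ε < (1 : ℝ), ∀ a, ‖(Λ (γ, s)).toOperator a - a‖ ≤ ε * ‖a‖) →
      s = 1) (γ : Circle) (s : H) :
    StrictMultiplierPiZero.mk A (Λ (γ, s)) = 1 ↔ s = 1 := by
  let B := leftMultiplierAlgebra A
  let Λ' : Circle × H →* invertibleIsometries B := Λ.toMonoidHom
  have hmem : StrictMultiplierPiZero.mk A (Λ (γ, s)) = 1 ↔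
      Λ' (γ, s) ∈ connectedComponent (1 : invertibleIsometries B) :=
    QuotientGroup.eq_one_iff (N := invertibleIsometriesZero B) (Λ' (γ, s))
  rw [hmem]
  constructor
  · intro h
    -- `V` is the image of the circle. By the gap it contains the ball of radius `1 / 2` around `1`,
    -- so it is an open, hence clopen, subgroup and contains the component.
    let V : Subgroup (invertibleIsometries B) :=
      (⊤ : Subgroup Circle).prod (⊥ : Subgroup H) |>.map Λ'
    have hV : (V : Set (invertibleIsometries B)) ∈ 𝓝 (1 : invertibleIsometries B) := by
      have hc : Continuous fun u : invertibleIsometries B => ((u : Bˣ) : B) :=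
        (isInducing_coe_invertibleIsometries B).continuous
      filter_upwards [hc.continuousAt (Metric.ball_mem_nhds _ one_half_pos)] with u hu
      obtain ⟨w, hw⟩ := Λ.surjective u
      refine ⟨w, ⟨trivial, hgap w.1 w.2 ⟨1 / 2, one_half_lt_one, fun a => ?_⟩⟩, hw⟩
      have h1 : ‖((u : Bˣ) : B).1 - ContinuousLinearMap.id ℂ A‖ ≤ 1 / 2 :=
        (mem_ball_iff_norm.1 hu).le
      have h2 := ContinuousLinearMap.le_of_opNorm_le _ h1 a
      rw [← hw] at h2
      exact h2
    have hVo : IsOpen (V : Set (invertibleIsometries B)) := V.isOpen_of_mem_nhds hV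
    have hVc : IsClopen (V : Set (invertibleIsometries B)) := ⟨V.isClosed_of_isOpen hVo, hVo⟩
    obtain ⟨w, hw, hws⟩ := hVc.connectedComponent_subset V.one_mem h
    have h3 : w = (γ, s) := Λ.injective hws
    rw [h3] at hw
    exact hw.2
  · rintro rfl
    -- Conversely the circle is connected and acts by scalars, which depend continuously on `γ` in
    -- norm.
    have hc : Continuous fun γ : Circle => Λ' (γ, 1) := by
      rw [(isInducing_coe_invertibleIsometries B).continuous_iff]
      have h1 : ((fun u : invertibleIsometries B => ((u : Bˣ) : B)) ∘ fun γ : Circle => Λ' (γ, 1))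
          = fun γ : Circle => (γ : ℂ) • (1 : B) := by
        funext γ
        refine Subtype.ext (ContinuousLinearMap.ext fun a => ?_)
        exact hscalar γ a
      rw [h1]
      have h2 : Continuous fun γ : Circle => (γ : ℂ) := continuous_subtype_val
      exact h2.smul (continuous_const (y := (1 : B)))
    have h2 := (isPreconnected_range hc).subset_connectedComponent (x := 1)
      ⟨1, map_one Λ'⟩
    exact h2 ⟨γ, rfl⟩

/-- The isomorphism `H ≃ π₀(𝒰(M_l(A)))` obtained from an isomorphism `𝕋 × H ≃ 𝒰(M_l(A))`. -/
theorem exists_continuousMulEquiv_piZero {H : Type*} [Group H] [TopologicalSpace H]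
    (Λ : (Circle × H) ≃ₜ* StrictMultiplierIsometries A)
    (hscalar : ∀ (γ : Circle) (a : A), (Λ (γ, 1)).toOperator a = (γ : ℂ) • a)
    (hgap : ∀ (γ : Circle) (s : H), (∃ ε < (1 : ℝ), ∀ a, ‖(Λ (γ, s)).toOperator a - a‖ ≤ ε * ‖a‖) →
      s = 1) :
    ∃ Λ' : H ≃ₜ* StrictMultiplierPiZero A, ∀ s, Λ' s = StrictMultiplierPiZero.mk A (Λ (1, s)) := by
  have hone := mk_eq_one_iff_of_norm_gap Λ.toMulEquiv hscalar hgap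
  let φ : H →* StrictMultiplierPiZero A :=
    ((StrictMultiplierPiZero.mk A).comp Λ.toMulEquiv.toMonoidHom).comp (MonoidHom.inr Circle H)
  have hφ : ∀ s, φ s = StrictMultiplierPiZero.mk A (Λ (1, s)) := fun s => rfl
  -- The class forgets the circle coordinate, so the inverse of `φ` is induced by the second
  -- coordinate of `Λ.symm`, which is strictly continuous.
  have hmk : ∀ w, StrictMultiplierPiZero.mk A (Λ w) = φ w.2 := by
    rintro ⟨γ, s⟩
    have h1 : (γ, s) = (γ, 1) * ((1 : Circle), s) := by simp
    have h2 : StrictMultiplierPiZero.mk A (Λ (γ, 1)) = 1 := (hone γ 1).2 rfl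
    rw [h1, map_mul, map_mul, h2, one_mul, ← hφ, ← h1]
  have hbij : Function.Bijective φ := by
    refine ⟨(injective_iff_map_eq_one φ).2 fun s hs => (hone 1 s).1 hs, fun q => ?_⟩
    obtain ⟨u, rfl⟩ := QuotientGroup.mk'_surjective (invertibleIsometriesZero _) q
    obtain ⟨w, hw⟩ := Λ.surjective u
    exact ⟨w.2, by rw [← hmk, hw]; rfl⟩
  let e : H ≃* StrictMultiplierPiZero A := MulEquiv.ofBijective φ hbij
  have hcont : Continuous (StrictMultiplierPiZero.mk A) := continuous_coinduced_rng
  refine ⟨{ e with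
    continuous_toFun := hcont.comp (Λ.continuous.comp (continuous_const.prodMk continuous_id))
    continuous_invFun := ?_ }, hφ⟩
  refine continuous_coinduced_dom.2 ?_
  have h1 : ∀ u, e.symm (StrictMultiplierPiZero.mk A u) = (Λ.symm u).2 := fun u => by
    rw [MulEquiv.symm_apply_eq]
    conv_lhs => rw [← Λ.apply_symm_apply u]
    exact hmk _
  exact (continuous_snd.comp Λ.symm.continuous).congr fun u => (h1 u).symm

end AbstractMultipliers

/-! ### The representation of `𝕋 × G` on `PF_p(G)` and the final isomorphisms -/

section RegularRepresentation

variable {G : Type*} [Group G] [TopologicalSpace G] [IsTopologicalGroup G]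
  [MeasurableSpace G] [BorelSpace G] [LocallyCompactSpace G] [T2Space G] (p : ℝ≥0∞)
  [Fact (1 ≤ p)] [Fact (p ≠ ∞)] (μ : Measure G) [μ.IsHaarMeasure] [μ.InnerRegularCompactLTTop]

/-- The isometric representation `(γ, s) ↦ γ λ_p(s)` of `𝕋 × G` on `L^p(G)`. -/
noncomputable def circleRegular (w : Circle × G) : Lp ℂ p μ →L[ℂ] Lp ℂ p μ :=
  (w.1 : ℂ) • leftRegular p μ w.2

theorem circleRegular_apply (w : Circle × G) (ξ : Lp ℂ p μ) :
    circleRegular p μ w ξ = (w.1 : ℂ) • leftRegular p μ w.2 ξ := rfl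

theorem circleRegular_mul (w z : Circle × G) :
    circleRegular p μ (w * z) = circleRegular p μ w * circleRegular p μ z := by
  ext1 ξ
  rw [mul_apply_eq_comp, circleRegular_apply, circleRegular_apply, circleRegular_apply, map_smul,
    smul_smul, Prod.fst_mul, Prod.snd_mul, Circle.coe_mul, leftRegular_mul_apply]

theorem circleRegular_one : circleRegular p μ (1 : Circle × G) = 1 := by
  ext1 ξ
  rw [circleRegular_apply, Prod.fst_one, Prod.snd_one, Circle.coe_one, one_smul, leftRegular_one]

theorem norm_circleRegular_apply (w : Circle × G) (ξ : Lp ℂ p μ) :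
    ‖circleRegular p μ w ξ‖ = ‖ξ‖ := by
  rw [circleRegular_apply, norm_smul, Circle.norm_coe, one_mul, norm_leftRegular_apply]

theorem norm_circleRegular_mul (w : Circle × G) (a : Lp ℂ p μ →L[ℂ] Lp ℂ p μ) :
    ‖circleRegular p μ w * a‖ = ‖a‖ :=
  ContinuousLinearMap.opNorm_ext _ _ fun ξ => norm_circleRegular_apply p μ w (a ξ)

theorem circleRegular_mul_mem (w : Circle × G) (a : pseudofunctions p μ) :
    circleRegular p μ w * a ∈ pseudofunctions p μ := by
  rw [circleRegular, smul_mul_assoc]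
  exact SMulMemClass.smul_mem _ (leftRegular_mul_mem p μ w.2 a)

/-- The action of `𝕋 × G` on `PF_p(G)` by left multiplication with `γ λ_p(s)`. -/
noncomputable def circleRegularAction :
    Circle × G →* (pseudofunctions p μ →L[ℂ] pseudofunctions p μ) where
  toFun w := LinearMap.mkContinuous
    { toFun := fun a => ⟨circleRegular p μ w * a, circleRegular_mul_mem p μ w a⟩
      map_add' := fun a b => Subtype.ext (mul_add _ _ _)
      map_smul' := fun c a => Subtype.ext (mul_smul_comm c (circleRegular p μ w) a.1) } 1
    fun a => (norm_circleRegular_mul p μ w a).le.trans (one_mul _).ge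
  map_one' := ContinuousLinearMap.ext fun a => Subtype.ext (by
    change circleRegular p μ 1 * a.1 = a.1
    rw [circleRegular_one, one_mul])
  map_mul' w z := ContinuousLinearMap.ext fun a => Subtype.ext (by
    change circleRegular p μ (w * z) * a.1 = circleRegular p μ w * (circleRegular p μ z * a.1)
    rw [circleRegular_mul, mul_assoc])

/-- The homomorphism `(γ, s) ↦ γ λ_p(s)` from `𝕋 × G` to `𝒰(M_l(PF_p(G)))`. -/
noncomputable def circleRegularHom :
    Circle × G →* StrictMultiplierIsometries (pseudofunctions p μ) :=
  StrictMultiplierIsometries.ofAction (circleRegularAction p μ)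
    (fun w a b => Subtype.ext (mul_assoc (circleRegular p μ w) a.1 b.1).symm)
    (fun w a => norm_circleRegular_mul p μ w a)

theorem circleRegularHom_toOperator (w : Circle × G) (a : pseudofunctions p μ) :
    ((circleRegularHom p μ w).toOperator a : Lp ℂ p μ →L[ℂ] Lp ℂ p μ)
      = circleRegular p μ w * a := rfl

/-- For `a = λ_p(f)` this is continuity of translation in `L¹`. Left multiplication by `λ_p(s)` is
isometric, so norm limits in `a` are uniform in `s`. -/
theorem continuous_leftRegular_mul (a : pseudofunctions p μ) :
    Continuous fun s : G => leftRegular p μ s * (a : Lp ℂ p μ →L[ℂ] Lp ℂ p μ) := by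
  have hnorm : ∀ (s : G) (b : Lp ℂ p μ →L[ℂ] Lp ℂ p μ), ‖leftRegular p μ s * b‖ = ‖b‖ := fun s b =>
    ContinuousLinearMap.opNorm_ext _ _ fun ξ => norm_leftRegular_apply p μ s (b ξ)
  refine pseudofunctions_induction p μ
    (P := fun a => Continuous fun s : G => leftRegular p μ s * a) ?_ (fun f => ?_) a
  · refine isClosed_of_closure_subset fun b hb => ?_
    refine continuous_of_uniform_approx_of_continuous fun V hV => ?_
    obtain ⟨ε, hε, hεV⟩ := Metric.mem_uniformity_dist.1 hV
    obtain ⟨c, hc, hbc⟩ := Metric.mem_closure_iff.1 hb ε hε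
    refine ⟨_, hc, fun s => hεV ?_⟩
    rwa [dist_eq_norm, ← mul_sub, hnorm, ← dist_eq_norm]
  · simp only [leftRegular_comp_leftConvolution]
    have : Fact ((1 : ℝ≥0∞) ≠ ∞) := ⟨ENNReal.one_ne_top⟩
    exact (leftConvolution p μ).continuous.comp (continuous_leftRegular_apply 1 μ f)

theorem continuous_circleRegularHom : Continuous (circleRegularHom p μ) := by
  refine StrictMultiplierIsometries.continuous_iff.2 fun a => continuous_induced_rng.2 ?_
  have h : Continuous fun w : Circle × G =>
      (w.1 : ℂ) • (leftRegular p μ w.2 * (a : Lp ℂ p μ →L[ℂ] Lp ℂ p μ)) :=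
    Continuous.smul (continuous_subtype_val.comp continuous_fst) ((continuous_leftRegular_mul p μ a).comp continuous_snd)
  refine h.congr fun w => ?_
  rw [Function.comp_apply, circleRegularHom_toOperator, circleRegular, smul_mul_assoc]

/-- Translations outside of a neighbourhood of `1` move some vector by at least its length. -/
theorem exists_norm_le_norm_circleRegular_sub {W : Set G} (hW : W ∈ 𝓝 (1 : G)) :
    ∃ ξ : Lp ℂ p μ, ξ ≠ 0 ∧ ∀ w : Circle × G, w.2 ∉ W → ‖ξ‖ ≤ ‖circleRegular p μ w ξ - ξ‖ := by
  have hp0 : p ≠ 0 := (zero_lt_one.trans_le (Fact.out : 1 ≤ p)).ne'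
  -- Choose `V` with `V * V⁻¹ ⊆ W`: for `w.2 ∉ W` the translate of `V` by `w.2` misses `V`, so on
  -- `V` the difference is just `-ξ`.
  have hc : Tendsto (fun w : G × G => w.1 * w.2⁻¹) (𝓝 1 ×ˢ 𝓝 1) (𝓝 1) := by
    have h : Continuous fun w : G × G => w.1 * w.2⁻¹ := by fun_prop
    rw [← nhds_prod_eq]
    simpa using h.tendsto (1, 1)
  obtain ⟨N, hN, hNW⟩ := mem_prod_same_iff.1 (mem_map.1 (hc hW))
  obtain ⟨V, hV1, hVN, hV⟩ := local_compact_nhds hN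
  have hVtop : μ V ≠ ∞ := hV.measure_lt_top.ne
  have hVpos : 0 < μ.real V :=
    ENNReal.toReal_pos (Measure.measure_pos_of_mem_nhds μ hV1).ne' hVtop
  refine ⟨indicatorConstLp p hV.measurableSet hVtop 1, ?_, fun w hw => ?_⟩
  · rw [← norm_pos_iff, norm_indicatorConstLp hp0 Fact.out]
    simp only [norm_one, one_mul]
    exact Real.rpow_pos_of_pos hVpos _
  · set ξ : Lp ℂ p μ := indicatorConstLp p hV.measurableSet hVtop 1 with hξ
    have hξ' : ξ =ᵐ[μ] V.indicator fun _ => (1 : ℂ) := indicatorConstLp_coeFn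
    refine Lp.norm_le_norm_of_ae_le ?_
    filter_upwards [hξ', (measurePreserving_mul_left μ w.2⁻¹).quasiMeasurePreserving.ae hξ',
      leftRegular_coeFn p μ w.2 ξ, Lp.coeFn_smul (w.1 : ℂ) (leftRegular p μ w.2 ξ),
      Lp.coeFn_sub (circleRegular p μ w ξ) ξ] with x h1 h2 h3 h4 h5
    rw [h5, Pi.sub_apply, circleRegular_apply, h4, Pi.smul_apply, h3, h1, h2]
    by_cases hx : x ∈ V
    · have hx' : w.2⁻¹ * x ∉ V := fun hx' => hw (by
        have := hNW (show ((x, w.2⁻¹ * x) : G × G) ∈ N ×ˢ N from ⟨hVN hx, hVN hx'⟩)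
        simpa using this)
      simp [hx, hx']
    · simp [hx]

/-- If the operators `γ λ_p(s)` converge strongly to `1` then `(γ, s)` converges to `1`. -/
theorem le_nhds_one_of_tendsto_circleRegular {l : Filter (Circle × G)}
    (h : ∀ ξ, Tendsto (fun w => circleRegular p μ w ξ) l (𝓝 ξ)) : l ≤ 𝓝 1 := by
  have h1 : Tendsto Prod.snd l (𝓝 (1 : G)) := by
    refine fun W hW => mem_map.2 ?_
    obtain ⟨ξ, hξ, hξW⟩ := exists_norm_le_norm_circleRegular_sub p μ hW
    filter_upwards [Metric.tendsto_nhds.1 (h ξ) ‖ξ‖ (norm_pos_iff.2 hξ)] with w hw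
    by_contra hw'
    rw [dist_eq_norm] at hw
    exact absurd hw (not_lt.2 (hξW w hw'))
  obtain ⟨ξ, hξ, -⟩ := exists_norm_le_norm_circleRegular_sub p μ (univ_mem (f := 𝓝 (1 : G)))
  have h2 : Tendsto (fun w : Circle × G => leftRegular p μ w.2 ξ) l (𝓝 ξ) := by
    have := ((continuous_leftRegular_apply p μ ξ).tendsto 1).comp h1
    rwa [leftRegular_one] at this
  -- Once the group coordinate converges, `γ λ_p(s) ξ - λ_p(s) ξ` tends to `0`, and its norm is `‖γ
  -- - 1‖ * ‖ξ‖`.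
  have h3 : Tendsto (fun w : Circle × G => (w.1 : ℂ)) l (𝓝 1) := by
    rw [tendsto_iff_norm_sub_tendsto_zero]
    have h4 := ((h ξ).sub h2).norm.div_const ‖ξ‖
    rw [sub_self, norm_zero, zero_div] at h4
    refine h4.congr fun w => ?_
    have h5 : circleRegular p μ w ξ - leftRegular p μ w.2 ξ
        = ((w.1 : ℂ) - 1) • leftRegular p μ w.2 ξ := by
      rw [circleRegular_apply, sub_smul, one_smul]
    rw [h5, norm_smul, norm_leftRegular_apply, mul_div_cancel_right₀ _ (norm_ne_zero_iff.2 hξ)]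
  have h6 : Tendsto (fun w : Circle × G => w.1) l (𝓝 1) :=
    (Topology.IsEmbedding.subtypeVal.tendsto_nhds_iff).2 h3
  exact h6.prodMk_nhds h1

/-- Strong convergence on `PF_p(G)` of the multipliers `γ λ_p(s)` implies convergence of
`(γ, s)`. -/
theorem le_nhds_one_of_tendsto_circleRegularHom {l : Filter (Circle × G)}
    (h : ∀ a, Tendsto (fun w => (circleRegularHom p μ w).toOperator a) l (𝓝 a)) : l ≤ 𝓝 1 := by
  refine le_nhds_one_of_tendsto_circleRegular p μ fun ξ => Metric.tendsto_nhds.2 fun ε hε => ?_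
  obtain ⟨K, hK⟩ := (Metric.tendsto_nhds.1 (tendsto_approximateUnit_apply p μ ξ) (ε / 3)
    (by positivity)).exists
  set a := approximateUnit p μ K
  have h1 : Tendsto (fun w => (circleRegular p μ w * (a : Lp ℂ p μ →L[ℂ] Lp ℂ p μ)) ξ) l
      (𝓝 ((a : Lp ℂ p μ →L[ℂ] Lp ℂ p μ) ξ)) :=
    ((ContinuousLinearMap.apply ℂ (Lp ℂ p μ) ξ).continuous.tendsto _).comp
      ((continuous_subtype_val.tendsto _).comp (h a))
  filter_upwards [Metric.tendsto_nhds.1 h1 (ε / 3) (by positivity)] with w hw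
  have h2 : dist (circleRegular p μ w ξ)
      ((circleRegular p μ w * (a : Lp ℂ p μ →L[ℂ] Lp ℂ p μ)) ξ) < ε / 3 := by
    rw [mul_apply_eq_comp, dist_eq_norm, ← map_sub, norm_circleRegular_apply, ← dist_eq_norm,
      dist_comm]
    exact hK
  have h3 := dist_triangle4 (circleRegular p μ w ξ)
    ((circleRegular p μ w * (a : Lp ℂ p μ →L[ℂ] Lp ℂ p μ)) ξ)
    ((a : Lp ℂ p μ →L[ℂ] Lp ℂ p μ) ξ) ξ
  linarith

/-- For `w` in the kernel the filter `pure w` satisfies the convergence hypothesis, hence lies below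
`𝓝 1`; separation gives `w = 1`. -/
theorem circleRegularHom_injective : Function.Injective (circleRegularHom p μ) := by
  refine (injective_iff_map_eq_one _).2 fun w hw => ?_
  have h : pure w ≤ 𝓝 (1 : Circle × G) := le_nhds_one_of_tendsto_circleRegularHom p μ fun a => by
    rw [tendsto_pure_left]
    intro s hs
    rw [hw]
    exact mem_of_mem_nhds hs
  exact pure_le_nhds_iff.1 h

theorem circleRegularHom_surjective (hp2 : p ≠ 2) : Function.Surjective (circleRegularHom p μ) := by
  intro u
  obtain ⟨T, hT⟩ := exists_linearIsometry_of_leftMultiplier (S := u.toOperator)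
    (S' := u⁻¹.toOperator) u.toOperator_apply_mul u⁻¹.toOperator_apply_mul
    u.toOperator.continuous u⁻¹.toOperator.continuous u.norm_toOperator_apply_le
    u⁻¹.norm_toOperator_apply_le u.inv_toOperator_apply
  have hTm : IsPseudofunctionMultiplier T := fun a => by
    rw [← hT]
    exact (u.toOperator a).2
  obtain ⟨c, s, hcs⟩ := hTm.exists_eq_smul_leftRegular hp2
  obtain ⟨ξ, hξ, -⟩ := exists_norm_le_norm_circleRegular_sub p μ (univ_mem (f := 𝓝 (1 : G)))
  have hc : ‖c‖ = 1 := by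
    have h1 := T.norm_map ξ
    rw [hcs, norm_smul, norm_leftRegular_apply] at h1
    exact (mul_eq_right₀ (norm_ne_zero_iff.2 hξ)).1 h1
  refine ⟨(⟨c, mem_sphere_zero_iff_norm.2 hc⟩, s), ?_⟩
  refine StrictMultiplierIsometries.toOperator_injective (ContinuousLinearMap.ext fun a =>
    Subtype.ext ?_)
  rw [hT, circleRegularHom_toOperator]
  exact ContinuousLinearMap.ext fun η => (hcs _).symm

/-- The isomorphism `𝕋 × G ≃ 𝒰(M_l(PF_p(G)))` of topological groups. -/
noncomputable def circleRegularEquiv (hp2 : p ≠ 2) :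
    (Circle × G) ≃ₜ* StrictMultiplierIsometries (pseudofunctions p μ) :=
  let e := MulEquiv.ofBijective (circleRegularHom p μ)
    ⟨circleRegularHom_injective p μ, circleRegularHom_surjective p μ hp2⟩
  { e with
    continuous_toFun := continuous_circleRegularHom p μ
    continuous_invFun := StrictMultiplierIsometries.continuous_symm e fun _ =>
      le_nhds_one_of_tendsto_circleRegularHom p μ }

theorem eq_one_of_norm_circleRegularHom_sub_le (γ : Circle) (s : G) (h : ∃ ε < (1 : ℝ), ∀ a,
    ‖(circleRegularHom p μ (γ, s)).toOperator a - a‖ ≤ ε * ‖a‖) : s = 1 := by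
  obtain ⟨ε, hε, h⟩ := h
  by_contra hs
  obtain ⟨ξ, hξ, hξs⟩ := exists_norm_le_norm_circleRegular_sub p μ
    (isOpen_ne.mem_nhds (Ne.symm hs) : {x : G | x ≠ s} ∈ 𝓝 (1 : G))
  have h1 : ‖ξ‖ ≤ ‖(circleRegular p μ (γ, s) - 1) ξ‖ := hξs (γ, s) fun h => h rfl
  -- `ε` is not assumed nonnegative, whereas the passage from multipliers to operators requires a
  -- nonnegative bound.
  have hε0 : 0 ≤ max ε 0 := le_max_right _ _
  have h2 : ‖(circleRegular p μ (γ, s) - 1) ξ‖ ≤ max ε 0 * ‖ξ‖ := by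
    refine norm_le_of_forall_comp_pseudofunction hε0 (fun a => ?_) ξ
    rw [sub_mul, one_mul]
    exact (h a).trans (mul_le_mul_of_nonneg_right (le_max_left _ _) (norm_nonneg _))
  have h3 : max ε 0 < 1 := max_lt hε one_pos
  have h4 := norm_pos_iff.2 hξ
  nlinarith

theorem circleRegularEquiv_scalar (hp2 : p ≠ 2) (γ : Circle) (a : pseudofunctions p μ) :
    (circleRegularEquiv p μ hp2 (γ, 1)).toOperator a = (γ : ℂ) • a := by
  refine Subtype.ext ?_
  change circleRegular p μ (γ, 1) * (a : Lp ℂ p μ →L[ℂ] Lp ℂ p μ) = (γ : ℂ) • a.1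
  rw [circleRegular, leftRegular_one, smul_one_mul]

theorem circleRegularEquiv_gap (hp2 : p ≠ 2) (γ : Circle) (s : G) (h : ∃ ε < (1 : ℝ), ∀ a,
    ‖(circleRegularEquiv p μ hp2 (γ, s)).toOperator a - a‖ ≤ ε * ‖a‖) : s = 1 :=
  eq_one_of_norm_circleRegularHom_sub_le p μ γ s h

theorem exists_piZeroEquiv (hp2 : p ≠ 2) :
    ∃ Λ' : G ≃ₜ* StrictMultiplierPiZero (pseudofunctions p μ),
      ∀ s, Λ' s = StrictMultiplierPiZero.mk (pseudofunctions p μ)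
        (circleRegularEquiv p μ hp2 (1, s)) :=
  exists_continuousMulEquiv_piZero (A := pseudofunctions p μ) (circleRegularEquiv p μ hp2)
    (circleRegularEquiv_scalar p μ hp2) (circleRegularEquiv_gap p μ hp2)

end RegularRepresentation

theorem mainTheorem7 {G : Type*} [Group G] [TopologicalSpace G] [IsTopologicalGroup G]
    [LocallyCompactSpace G] [T2Space G] [MeasurableSpace G] [BorelSpace G]
    (μ : Measure G) [μ.IsHaarMeasure] [μ.InnerRegularCompactLTTop]
    (p : ℝ≥0∞) [Fact (1 ≤ p)] [Fact (p ≠ ∞)] (hp1 : 1 < p) (hp2 : p ≠ 2) :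
    ∃ (Λ : (Circle × G) ≃ₜ* StrictMultiplierIsometries (pseudofunctions p μ))
      (Λ' : G ≃ₜ* StrictMultiplierPiZero (pseudofunctions p μ)),
      (∀ (γ : Circle) (s : G) (a : pseudofunctions p μ),
        (((Λ (γ, s)).toOperator a : pseudofunctions p μ) : Lp ℂ p μ →L[ℂ] Lp ℂ p μ)
          = ((γ : ℂ) • leftRegular p μ s) ∘L (a : Lp ℂ p μ →L[ℂ] Lp ℂ p μ)) ∧
      (∀ s : G, Λ' s = StrictMultiplierPiZero.mk (pseudofunctions p μ) (Λ (1, s))) := by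
  obtain ⟨Λ', hΛ'⟩ := exists_piZeroEquiv p μ hp2
  exact ⟨circleRegularEquiv p μ hp2, Λ', fun γ s a => rfl, hΛ'⟩
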